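/- Let $G$ be a discrete group. A compact $G$-space is a compact Hausdorff space $X$ on which $G$ acts by homeomorphisms. It is a \emph{$G$-boundary} if it is non-empty, the action is minimal (every orbit is dense), and the action is strongly proximal (for every regular Borel probability measure $\nu$ on $X$, the weak* closure of the orbit $G\nu$ contains a point mass $\delta_x$, $x \in X$). The action on $X$ is \emph{topologically free} if for every $s \in G \setminus \{e\}$ the set $\{x \in X \mid sx \neq x\}$ is dense in $X$. The \emph{Furstenberg boundary} $\partial_F G$ is the universal $G$-boundary, i.e. a $G$-boundary such that every $G$-boundary is a continuous $G$-equivariant image of it. Let $\mathrm{C}^*_r(G)$ be the reduced C*-algebra of $G$, generated by the left regular representation on $\ell^2(G)$, and for a compact $G$-space $X$ let $C(X) \rtimes_r G$ be the reduced crossed product. A C*-algebra is \emph{simple} if it is non-zero and its only closed two-sided ideals are $\{0\}$ and the whole algebra. The Furstenberg boundary $\partial_F G$ exists, and the following are equivalent: \begin{enumerate} \item The group $G$ is C*-simple, i.e. the reduced C*-algebra $\mathrm{C}^*_r(G)$ is simple. \item The reduced crossed product $C(\partial_F G) \rtimes_r G$ is simple. \item The reduced crossed product $C(B) \rtimes_r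 G$ is simple for some $G$-boundary $B$. \item The $G$-action on $\partial_F G$ is topologically free. \item The $G$-action on some $G$-boundary is topologically free. \end{enumerate} -/

import Mathlib

open MeasureTheory
open scoped ENNReal

universe u

noncomputable section

/-! ### Compact `G`-spaces, boundaries and the Furstenberg boundary

A compact `G`-space of a discrete group `G` is a compact Hausdorff space `X` on which `G` acts by
homeomorphisms: `[CompactSpace X] [T2Space X] [MulAction G X] [ContinuousConstSMul G X]`. -/

/-- The translate `s ν`, i.e. `(s ν)(Y) = ν (s⁻¹ Y)`, of a Borel probability measure `ν`. -/
def translateProba {G X : Type*} [Group G] [TopologicalSpace X] [MeasurableSpace X] [BorelSpace X]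
    [MulAction G X] [ContinuousConstSMul G X] (s : G) (ν : ProbabilityMeasure X) :
    ProbabilityMeasure X :=
  ν.map (f := fun x => s • x) (continuous_const_smul s).measurable.aemeasurable

/-- The `G`-action on `X` is strongly proximal: the weak* closure of the `G`-orbit of every regular
Borel probability measure contains a point mass. (The topology of `ProbabilityMeasure X` is that of
convergence against continuous functions.) -/
def IsStronglyProximal (G X : Type*) [Group G] [TopologicalSpace X] [MulAction G X]
    [ContinuousConstSMul G X] : Prop :=
  letI : MeasurableSpace X := borel X
  haveI : BorelSpace X := ⟨rfl⟩
  ∀ ν : ProbabilityMeasure X, (ν : Measure X).Regular →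
    ∃ x : X, diracProba x ∈ closure (Set.range fun s : G => translateProba s ν)

/-- A compact `G`-space is a `G`-boundary if it is non-empty, minimal and strongly proximal. -/
structure IsGBoundary (G X : Type*) [Group G] [TopologicalSpace X] [CompactSpace X] [T2Space X]
    [MulAction G X] [ContinuousConstSMul G X] : Prop where
  nonempty : Nonempty X
  minimal : MulAction.IsMinimal G X
  stronglyProximal : IsStronglyProximal G X

/-- `X` is the Furstenberg boundary of `G`, i.e. the universal `G`-boundary: it is a `G`-boundary,
and every `G`-boundary is a continuous `G`-equivariant image of `X`. Every `G`-boundary is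
a quotient of the Stone–Čech compactification `Ultrafilter G` of the discrete space `G`, so
the universe of `G` contains a copy of every `G`-boundary. -/
structure IsFurstenbergBoundary (G X : Type u) [Group G] [TopologicalSpace X] [CompactSpace X]
    [T2Space X] [MulAction G X] [ContinuousConstSMul G X] : Prop where
  isGBoundary : IsGBoundary G X
  universal : ∀ (Y : Type u) [TopologicalSpace Y] [CompactSpace Y] [T2Space Y] [MulAction G Y]
    [ContinuousConstSMul G Y], IsGBoundary G Y →
      ∃ φ : X → Y, Continuous φ ∧ Function.Surjective φ ∧ ∀ (s : G) (x : X), φ (s • x) = s • φ x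

/-- The `G`-action on `X` is topologically free: for `s ≠ 1` the points moved by `s` are dense. -/
def IsTopologicallyFree (G X : Type*) [Group G] [TopologicalSpace X] [MulAction G X] : Prop :=
  ∀ s : G, s ≠ 1 → Dense {x : X | s • x ≠ x}

/-! ### Operators on `ℓ²(ι)` -/

/-- The Hilbert space `ℓ²(ι)`. -/
abbrev EllTwo (ι : Type*) : Type _ := lp (fun _ : ι => ℂ) 2

theorem memEllTwo_perm {ι : Type*} (e : Equiv.Perm ι) (ξ : EllTwo ι) :
    Memℓp (fun i => ξ (e.symm i)) 2 := by
  refine memℓp_gen ?_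
  exact (e.symm.summable_iff (f := fun i => ‖ξ i‖ ^ (2 : ℝ≥0∞).toReal)).2
    ((lp.memℓp ξ).summable (by norm_num))

/-- The unitary operator on `ℓ²(ι)` given by a permutation `e` of `ι`: `ξ ↦ ξ ∘ e⁻¹`. -/
def permOp {ι : Type*} (e : Equiv.Perm ι) : EllTwo ι →L[ℂ] EllTwo ι :=
  LinearMap.mkContinuous
    { toFun := fun ξ => ⟨fun i => ξ (e.symm i), memEllTwo_perm e ξ⟩
      map_add' := fun _ _ => rfl
      map_smul' := fun _ _ => rfl } 1 (by
    intro ξ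
    rw [one_mul, lp.norm_eq_tsum_rpow (by norm_num), lp.norm_eq_tsum_rpow (by norm_num)]
    exact le_of_eq (congrArg (· ^ (1 / (2 : ℝ≥0∞).toReal))
      (e.symm.tsum_eq (fun i => ‖ξ i‖ ^ (2 : ℝ≥0∞).toReal))))

@[simp]
theorem permOp_apply {ι : Type*} (e : Equiv.Perm ι) (ξ : EllTwo ι) (i : ι) :
    permOp e ξ i = ξ (e.symm i) := rfl

theorem memEllTwo_mul {ι : Type*} (φ : ι → ℂ) (C : ℝ) (h : ∀ i, ‖φ i‖ ≤ C) (ξ : EllTwo ι) :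
    Memℓp (fun i => φ i * ξ i) 2 := by
  refine ((lp.memℓp ξ).const_smul (C : ℂ)).mono' fun i => ?_
  rw [norm_mul, Pi.smul_apply, norm_smul, Complex.norm_real]
  exact mul_le_mul_of_nonneg_right ((h i).trans (le_abs_self C)) (norm_nonneg _)

/-- The operator on `ℓ²(ι)` of multiplication by a function `φ` bounded by `C`. -/
def mulOp {ι : Type*} (φ : ι → ℂ) (C : ℝ) (h : ∀ i, ‖φ i‖ ≤ C) : EllTwo ι →L[ℂ] EllTwo ι :=
  LinearMap.mkContinuous
    { toFun := fun ξ => ⟨fun i => φ i * ξ i, memEllTwo_mul φ C h ξ⟩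
      map_add' := fun ξ η => by
        ext i
        exact mul_add (φ i) (ξ i) (η i)
      map_smul' := fun c ξ => by
        ext i
        exact mul_left_comm (φ i) c (ξ i) } |C| (by
    intro ξ
    have h2 : ‖(C : ℂ) • ξ‖ = |C| * ‖ξ‖ := by rw [norm_smul, Complex.norm_real, Real.norm_eq_abs]
    rw [← h2]
    refine lp.norm_mono (by norm_num) fun i => ?_
    change ‖φ i * ξ i‖ ≤ ‖(C : ℂ) * ξ i‖
    rw [norm_mul, norm_mul, Complex.norm_real]
    exact mul_le_mul_of_nonneg_right ((h i).trans (le_abs_self C)) (norm_nonneg _))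

@[simp]
theorem mulOp_apply {ι : Type*} (φ : ι → ℂ) (C : ℝ) (h : ∀ i, ‖φ i‖ ≤ C) (ξ : EllTwo ι) (i : ι) :
    mulOp φ C h ξ i = φ i * ξ i := rfl

/-! ### Reduced group C*-algebras and reduced crossed products -/

/-- The left regular representation of `G` on `ℓ²(G)`: `(λ_s ξ)(t) = ξ(s⁻¹ t)`. -/
def leftRegular (G : Type*) [Group G] (s : G) : EllTwo G →L[ℂ] EllTwo G :=
  permOp (Equiv.mulLeft s)

/-- The reduced C*-algebra of the discrete group `G`: the C*-algebra of operators on `ℓ²(G)`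
generated by the left regular representation. -/
def reducedGroupCStar (G : Type*) [Group G] : StarSubalgebra ℂ (EllTwo G →L[ℂ] EllTwo G) :=
  (StarAlgebra.adjoin ℂ (Set.range (leftRegular G))).topologicalClosure

/-- The unitary `1 ⊗ λ_s` on `ℓ²(G × X) = ℓ²(G, ℓ²(X))`: `(λ_s ξ)(t, x) = ξ(s⁻¹ t, x)`. -/
def crossedUnitary (G X : Type*) [Group G] (s : G) : EllTwo (G × X) →L[ℂ] EllTwo (G × X) :=
  permOp ((Equiv.mulLeft s).prodCongr (Equiv.refl X))

/-- The copy of `f ∈ C(X)` on `ℓ²(G × X) = ℓ²(G, ℓ²(X))`: with `C(X)` faithfully represented on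
`ℓ²(X)` by multiplication, `(f ξ)(t) = (t⁻¹ f) ξ(t)`, and `(t⁻¹ f)(x) = f (t x)`. -/
def crossedFunction (G X : Type*) [Group G] [TopologicalSpace X] [CompactSpace X] [MulAction G X]
    (f : C(X, ℂ)) : EllTwo (G × X) →L[ℂ] EllTwo (G × X) :=
  mulOp (fun p : G × X => f (p.1 • p.2)) ‖f‖ (fun p => f.norm_coe_le_norm (p.1 • p.2))

/-- The reduced crossed product `C(X) ⋊_r G` of a compact `G`-space `X`: the C*-algebra of operators
on `ℓ²(G, ℓ²(X))` generated by the regular representation that is induced by the faithful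
representation of `C(X)` on `ℓ²(X)` by multiplication. -/
def reducedCrossedProduct (G X : Type*) [Group G] [TopologicalSpace X] [CompactSpace X]
    [MulAction G X] : StarSubalgebra ℂ (EllTwo (G × X) →L[ℂ] EllTwo (G × X)) :=
  (StarAlgebra.adjoin ℂ
    (Set.range (crossedFunction G X) ∪ Set.range (crossedUnitary G X))).topologicalClosure

/-- A (unital) C*-algebra is simple if it is non-zero and has no closed two-sided ideals other than
zero and the whole algebra. -/
def IsCStarSimple (A : Type*) [Ring A] [TopologicalSpace A] : Prop :=
  Nontrivial A ∧ ∀ I : TwoSidedIdeal A, IsClosed (I : Set A) → I = ⊥ ∨ I = ⊤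

end

open Filter Topology Set
open scoped BoundedContinuousFunction InnerProductSpace CompactlySupported

noncomputable section

/-! ### States on `C(X, ℝ)` and strong proximality -/

/-! Existence. Among the compact convex invariant sets of means on `G` take a minimal one `K`, and
inside `K` a minimal closed invariant set `S`. Given a state on `C(S)`, minimality of `K` makes
every point of `K` the barycentre of a state in the closed convex hull of the orbit. For an extreme
point that state is a point mass (Bauer), and a point mass in the hull of an orbit lies in its
closure. So `S` is a boundary. It is universal because a mean on `G`, pushed along an orbit of
another boundary, gives a state, which proximality and minimality turn into a point mass. The
construction also leaves an equivariant family of means on `G` indexed by the boundary. This is the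
amenability used later.

Both directions between freeness and simplicity rest on `exists_functional_eval`. Conjugate a state
by the group unitaries of a covariant representation of `X`. Strong proximality produces a limit `ψ`
that is evaluation at a prescribed `x` on `C(X)`, and then `ψ (f T) = f x * ψ T = ψ (T f)`.

Freeness gives simplicity (`isCStarSimple_of_isTopologicallyFree`): a state vanishing on a proper
ideal still vanishes there after conjugation and limits. If `x` is moved by the finitely many group
elements of a sum, `ψ` reads off its coefficient at `1`. Such `x` are dense, so elements of the
ideal have zero coefficient at `1`; applied to `star a * a`, this gives `a = 0`.

Simplicity gives freeness (`isTopologicallyFree_of_isCStarSimple`): by the means, the representation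
on `ℓ²(X)` is weakly contained in the regular ones (`norm_orbitRep_ev_le`), so simplicity makes the
norms equal and "coefficient at `1`, evaluated at a point" extends to a state on all operators on
`ℓ²(X)`. These include `C(X)`. Moving the state to evaluation at `x` keeps it zero on `u s` for `s ≠
1`; but if `s` fixed a neighbourhood of `x`, a bump function there would force the value `1`. -/

theorem mem_closure_range_iff_comap_neBot {α β : Type*} [TopologicalSpace β] {f : α → β} {b : β} :
    b ∈ closure (range f) ↔ (comap f (𝓝 b)).NeBot := by
  rw [mem_closure_iff_nhds, comap_neBot_iff]
  refine forall₂_congr fun t _ => ⟨?_, ?_⟩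
  · rintro ⟨_, ht, a, rfl⟩
    exact ⟨a, ht⟩
  · rintro ⟨a, ha⟩
    exact ⟨f a, ha, a, rfl⟩

theorem mem_closure_range_iff_exists_filter {α β : Type*} [TopologicalSpace β] {f : α → β} {b : β} :
    b ∈ closure (range f) ↔ ∃ l : Filter α, l.NeBot ∧ Tendsto f l (𝓝 b) := by
  constructor
  · exact fun h => ⟨_, mem_closure_range_iff_comap_neBot.1 h, tendsto_comap⟩
  · rintro ⟨l, hl, h⟩
    exact mem_closure_of_tendsto h (Eventually.of_forall mem_range_self)

/-- The function `x ↦ f (s x)`. -/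
def shift {G X R : Type*} [Group G] [TopologicalSpace X] [TopologicalSpace R] [MulAction G X]
    [ContinuousConstSMul G X] (s : G) (f : C(X, R)) : C(X, R) :=
  f.comp ⟨fun x => s • x, continuous_const_smul s⟩

@[simp]
theorem shift_apply {G X R : Type*} [Group G] [TopologicalSpace X] [TopologicalSpace R]
    [MulAction G X] [ContinuousConstSMul G X] (s : G) (f : C(X, R)) (x : X) :
    shift s f x = f (s • x) := rfl

theorem shift_mul {G X R : Type*} [Group G] [TopologicalSpace X] [TopologicalSpace R]
    [MulAction G X] [ContinuousConstSMul G X] (s t : G) (f : C(X, R)) :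
    shift (s * t) f = shift t (shift s f) := by
  ext x
  simp [mul_smul]

@[simp]
theorem shift_one {G X R : Type*} [Group G] [TopologicalSpace X] [TopologicalSpace R]
    [MulAction G X] [ContinuousConstSMul G X] (f : C(X, R)) : shift (1 : G) f = f := by
  ext x
  simp

/-- A positive unital linear functional on `C(X, ℝ)`. -/
structure IsState {X : Type*} [TopologicalSpace X] (L : C(X, ℝ) →ₗ[ℝ] ℝ) : Prop where
  nonneg : ∀ f, 0 ≤ f → 0 ≤ L f
  one : L 1 = 1

namespace IsState

variable {X : Type*} [TopologicalSpace X] {L : C(X, ℝ) →ₗ[ℝ] ℝ}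

theorem mono (h : IsState L) {f g : C(X, ℝ)} (hfg : f ≤ g) : L f ≤ L g := by
  have := h.nonneg (g - f) (sub_nonneg.2 hfg)
  rwa [map_sub, sub_nonneg] at this

theorem apply_le (h : IsState L) {f : C(X, ℝ)} {c : ℝ} (hf : ∀ x, f x ≤ c) : L f ≤ c := by
  have : L f ≤ L (c • (1 : C(X, ℝ))) := h.mono fun x => by simpa using hf x
  simpa [h.one] using this

theorem le_apply (h : IsState L) {f : C(X, ℝ)} {c : ℝ} (hf : ∀ x, c ≤ f x) : c ≤ L f := by
  have : L (c • (1 : C(X, ℝ))) ≤ L f := h.mono fun x => by simpa using hf x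
  simpa [h.one] using this

theorem abs_apply_le (h : IsState L) [CompactSpace X] (f : C(X, ℝ)) : |L f| ≤ ‖f‖ :=
  abs_le.2 ⟨h.le_apply fun x => (abs_le.1 (f.norm_coe_le_norm x)).1,
    h.apply_le fun x => (abs_le.1 (f.norm_coe_le_norm x)).2⟩

theorem of_apply_le (h : ∀ (f : C(X, ℝ)) (c : ℝ), (∀ x, f x ≤ c) → L f ≤ c) : IsState L where
  nonneg f hf := by
    have := h (-f) 0 fun x => by simpa using hf x
    simpa using this
  one := by
    have h1 := h 1 1 fun x => le_rfl
    have h2 := h (-1) (-1) fun x => le_rfl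
    rw [map_neg] at h2
    linarith

end IsState

section Proximal

variable {G X : Type*} [Group G] [TopologicalSpace X] [MulAction G X] [ContinuousConstSMul G X]

theorem integral_translateProba [MeasurableSpace X] [BorelSpace X] (s : G)
    (ν : ProbabilityMeasure X) (f : C(X, ℝ)) :
    ∫ x, f x ∂(translateProba s ν : Measure X) = ∫ x, shift s f x ∂(ν : Measure X) := by
  rw [translateProba, ProbabilityMeasure.toMeasure_map,
    integral_map (continuous_const_smul s).measurable.aemeasurable
      f.continuous.measurable.aestronglyMeasurable]
  rfl

variable [CompactSpace X]

theorem tendsto_translateProba_iff [MeasurableSpace X] [BorelSpace X]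
    (ν : ProbabilityMeasure X) (x : X) (l : Filter G) :
    Tendsto (fun s : G => translateProba s ν) l (𝓝 (diracProba x)) ↔
      Tendsto (fun s : G => fun f : C(X, ℝ) => ∫ y, shift s f y ∂(ν : Measure X)) l
        (𝓝 fun f => f x) := by
  rw [ProbabilityMeasure.tendsto_iff_forall_integral_tendsto, tendsto_pi_nhds]
  have key : ∀ f : C(X, ℝ), ∫ y, f y ∂(diracProba x : Measure X) = f x := fun f =>
    integral_dirac' _ _ f.continuous.measurable.stronglyMeasurable
  constructor
  · intro h f
    have := h (BoundedContinuousFunction.mkOfCompact f)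
    simp only [BoundedContinuousFunction.mkOfCompact_apply, key, integral_translateProba] at this
    exact this
  · intro h f
    have := h f.toContinuousMap
    simp only [← integral_translateProba] at this
    rw [← key] at this
    exact this

theorem exists_regular_integral_eq {X : Type*} [TopologicalSpace X] [CompactSpace X] [T2Space X]
    [MeasurableSpace X] [BorelSpace X] {L : C(X, ℝ) →ₗ[ℝ] ℝ}
    (hL : IsState L) :
    ∃ ν : ProbabilityMeasure X, (ν : Measure X).Regular ∧
      ∀ f : C(X, ℝ), ∫ y, f y ∂(ν : Measure X) = L f := by
  let Λ : C_c(X, ℝ) →ₚ[ℝ] ℝ := PositiveLinearMap.mk₀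
    { toFun := fun f => L f.toContinuousMap
      map_add' := fun f g => map_add L _ _
      map_smul' := fun c f => map_smul L c _ } fun f hf => hL.nonneg _ hf
  have key : ∀ f : C(X, ℝ), ∫ y, f y ∂(RealRMK.rieszMeasure Λ) = L f := fun f =>
    RealRMK.integral_rieszMeasure Λ (CompactlySupportedContinuousMap.continuousMapEquiv f)
  have hfin : IsFiniteMeasure (RealRMK.rieszMeasure Λ) :=
    ⟨IsCompact.measure_lt_top isCompact_univ⟩
  have hprob : IsProbabilityMeasure (RealRMK.rieszMeasure Λ) := by
    have := key 1
    simp only [ContinuousMap.one_apply, integral_const, smul_eq_mul, mul_one, hL.one] at this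
    exact ⟨by simpa [Measure.real, ENNReal.toReal_eq_one_iff] using this⟩
  exact ⟨⟨_, hprob⟩, RealRMK.regular_rieszMeasure Λ, key⟩

variable [T2Space X]

/-- By Riesz representation regular probability measures are the states on `C(X, ℝ)`; measures are
not needed after this point. -/
theorem isStronglyProximal_iff : IsStronglyProximal G X ↔
    ∀ L : C(X, ℝ) →ₗ[ℝ] ℝ, IsState L → ∃ x : X, (fun f : C(X, ℝ) => f x) ∈
      closure (range fun s : G => fun f : C(X, ℝ) => L (shift s f)) := by
  let : MeasurableSpace X := borel X
  have : BorelSpace X := ⟨rfl⟩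
  constructor
  · intro h L hL
    obtain ⟨ν, hν, hint⟩ := exists_regular_integral_eq hL
    obtain ⟨x, hx⟩ := h ν hν
    obtain ⟨l, hl, hlim⟩ := mem_closure_range_iff_exists_filter.1 hx
    rw [tendsto_translateProba_iff] at hlim
    simp only [hint] at hlim
    exact ⟨x, mem_closure_range_iff_exists_filter.2 ⟨l, hl, hlim⟩⟩
  · intro h ν _
    have hi : ∀ f : C(X, ℝ), Integrable f (ν : Measure X) := fun f =>
      (BoundedContinuousFunction.mkOfCompact f).integrable _
    let L : C(X, ℝ) →ₗ[ℝ] ℝ :=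
      { toFun := fun f => ∫ y, f y ∂(ν : Measure X)
        map_add' := fun f g => integral_add (hi f) (hi g)
        map_smul' := fun c f => integral_smul c f }
    obtain ⟨x, hx⟩ := h L ⟨fun f hf => integral_nonneg hf, by simp [L]⟩
    obtain ⟨l, hl, hlim⟩ := mem_closure_range_iff_exists_filter.1 hx
    exact ⟨x, mem_closure_range_iff_exists_filter.2
      ⟨l, hl, (tendsto_translateProba_iff ν x l).2 hlim⟩⟩

/-- Strong proximality supplies one point mass. The orbit closure is invariant, and orbits in `X`
are dense by minimality, so every point mass is reached. -/
theorem IsGBoundary.mem_closure_orbit (h : IsGBoundary G X) {L : C(X, ℝ) →ₗ[ℝ] ℝ}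
    (hL : IsState L) (x : X) : (fun f : C(X, ℝ) => f x) ∈
      closure (range fun s : G => fun f : C(X, ℝ) => L (shift s f)) := by
  obtain ⟨y, hy⟩ := isStronglyProximal_iff.1 h.stronglyProximal L hL
  set C := closure (range fun s : G => fun f : C(X, ℝ) => L (shift s f)) with hC
  have hinv : ∀ t : G, (fun f : C(X, ℝ) => f (t • y)) ∈ C := by
    intro t
    have hcont : Continuous fun (m : C(X, ℝ) → ℝ) (f : C(X, ℝ)) => m (shift t f) :=
      continuous_pi fun f => continuous_apply _
    refine map_mem_closure hcont hy ?_
    rintro _ ⟨s, rfl⟩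
    refine ⟨t * s, ?_⟩
    funext f
    change L (shift (t * s) f) = L (shift s (shift t f))
    rw [shift_mul]
  have hev : Continuous fun (z : X) (f : C(X, ℝ)) => f z := continuous_pi fun f => f.continuous
  have hd : x ∈ closure (MulAction.orbit G y) := h.minimal.dense_orbit y x
  refine isClosed_closure.closure_subset (map_mem_closure hev hd ?_)
  rintro _ ⟨t, rfl⟩
  exact hinv t

end Proximal

end

noncomputable section

/-! ### Means on a discrete group and the existence of the Furstenberg boundary -/

theorem exists_minimal_nonempty_isClosed {V : Type*} [TopologicalSpace V] (P : Set V → Prop)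
    (hP : ∀ c : Set (Set V), (∀ s ∈ c, P s) → P (⋂₀ c)) {K : Set V} (hK : IsCompact K)
    (hKc : IsClosed K) (hne : K.Nonempty) (hPK : P K) :
    ∃ m ⊆ K, m.Nonempty ∧ IsClosed m ∧ P m ∧
      ∀ m' ⊆ m, m'.Nonempty → IsClosed m' → P m' → m' = m := by
  obtain ⟨m, hmK, hm⟩ := zorn_superset_nonempty
    {s : Set V | s ⊆ K ∧ s.Nonempty ∧ IsClosed s ∧ P s} (fun c hc hchain hcne => by
      refine ⟨⋂₀ c, ⟨?_, ?_, ?_, hP c fun s hs => (hc hs).2.2.2⟩,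
        fun s hs => sInter_subset_of_mem hs⟩
      · obtain ⟨s, hs⟩ := hcne
        exact (sInter_subset_of_mem hs).trans (hc hs).1
      · have : Nonempty c := hcne.to_subtype
        exact IsCompact.nonempty_sInter_of_directed_nonempty_isCompact_isClosed
          (fun a ha b hb => (hchain.total ha hb).elim (fun h => ⟨a, ha, Subset.rfl, h⟩)
            fun h => ⟨b, hb, h, Subset.rfl⟩) (fun s hs => (hc hs).2.1)
          (fun s hs => hK.of_isClosed_subset (hc hs).2.2.1 (hc hs).1) (fun s hs => (hc hs).2.2.1)
      · exact isClosed_sInter fun s hs => (hc hs).2.2.1) K ⟨Subset.rfl, hne, hKc, hPK⟩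
  refine ⟨m, hmK, hm.prop.2.1, hm.prop.2.2.1, hm.prop.2.2.2, fun m' h1 h2 h3 h4 => ?_⟩
  exact (hm.eq_of_le ⟨h1.trans hmK, h2, h3, h4⟩ h1).symm ▸ rfl

variable {G : Type u} [Group G] [TopologicalSpace G] [DiscreteTopology G]

/-- The function `t ↦ a (s t)`. -/
def bshift (s : G) (a : G →ᵇ ℝ) : G →ᵇ ℝ :=
  a.compContinuous ⟨fun t => s * t, continuous_of_discreteTopology⟩

@[simp]
theorem bshift_apply (s : G) (a : G →ᵇ ℝ) (t : G) : bshift s a t = a (s * t) := rfl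

theorem bshift_mul (s t : G) (a : G →ᵇ ℝ) : bshift (s * t) a = bshift t (bshift s a) := by
  ext r
  simp [mul_assoc]

/-- A mean on `G`: a linear functional on bounded functions that respects upper bounds. -/
structure IsMean (m : (G →ᵇ ℝ) → ℝ) : Prop where
  linear : IsLinearMap ℝ m
  apply_le : ∀ a c, (∀ t, a t ≤ c) → m a ≤ c

/-- A set of functionals that is the intersection of the half-spaces that contain it. -/
def IsHullClosed (K : Set ((G →ᵇ ℝ) → ℝ)) : Prop :=
  ∀ m, IsLinearMap ℝ m → (∀ a c, (∀ k ∈ K, k a ≤ c) → m a ≤ c) → m ∈ K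

/-- Invariance of a set of functionals under translations. -/
def IsShiftInvariant (K : Set ((G →ᵇ ℝ) → ℝ)) : Prop :=
  ∀ (s : G), ∀ m ∈ K, (fun a => m (bshift s a)) ∈ K

omit [Group G] [DiscreteTopology G] in
theorem isClosed_isLinearMap : IsClosed {m : (G →ᵇ ℝ) → ℝ | IsLinearMap ℝ m} := by
  have : {m : (G →ᵇ ℝ) → ℝ | IsLinearMap ℝ m} =
      (⋂ (a) (b), {m | m (a + b) = m a + m b}) ∩ ⋂ (c : ℝ) (a), {m | m (c • a) = c • m a} := by
    ext m
    simp only [mem_ofPred_eq, mem_inter_iff, mem_iInter]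
    exact ⟨fun h => ⟨h.map_add, h.map_smul⟩, fun h => ⟨h.1, h.2⟩⟩
  rw [this]
  refine IsClosed.inter (isClosed_iInter fun a => isClosed_iInter fun b => ?_)
    (isClosed_iInter fun c => isClosed_iInter fun a => ?_)
  · exact isClosed_eq (continuous_apply _) ((continuous_apply a).add (continuous_apply b))
  · exact isClosed_eq (continuous_apply _) ((continuous_apply _).const_smul c)

omit [Group G] [DiscreteTopology G] in
theorem isClosed_isMean : IsClosed {m : (G →ᵇ ℝ) → ℝ | IsMean m} := by
  have : {m : (G →ᵇ ℝ) → ℝ | IsMean m} = {m | IsLinearMap ℝ m} ∩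
      ⋂ (a : G →ᵇ ℝ) (c : ℝ) (_ : ∀ t, a t ≤ c), {m | m a ≤ c} := by
    ext m
    simp only [mem_ofPred_eq, mem_inter_iff, mem_iInter]
    exact ⟨fun h => ⟨h.1, h.2⟩, fun h => ⟨h.1, h.2⟩⟩
  rw [this]
  exact isClosed_isLinearMap.inter (isClosed_iInter fun a => isClosed_iInter fun c =>
    isClosed_iInter fun _ => isClosed_le (continuous_apply _) continuous_const)

omit [Group G] [DiscreteTopology G] in
theorem IsMean.le_apply {m : (G →ᵇ ℝ) → ℝ} (h : IsMean m) {a : G →ᵇ ℝ} {c : ℝ}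
    (hc : ∀ t, c ≤ a t) : c ≤ m a := by
  have := h.apply_le (-a) (-c) fun t => neg_le_neg (hc t)
  rw [h.linear.map_neg] at this
  linarith

omit [Group G] [DiscreteTopology G] in
theorem isCompact_isMean : IsCompact {m : (G →ᵇ ℝ) → ℝ | IsMean m} := by
  refine (isCompact_univ_pi fun a : G →ᵇ ℝ =>
    isCompact_Icc (a := -‖a‖) (b := ‖a‖)).of_isClosed_subset isClosed_isMean ?_
  intro m hm a _
  exact ⟨hm.le_apply fun t => (abs_le.1 (a.norm_coe_le_norm t)).1,
    hm.apply_le _ _ fun t => (abs_le.1 (a.norm_coe_le_norm t)).2⟩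

theorem exists_minimal_means : ∃ K : Set ((G →ᵇ ℝ) → ℝ), K ⊆ {m | IsMean m} ∧ K.Nonempty ∧
    IsClosed K ∧ IsHullClosed K ∧ IsShiftInvariant K ∧ ∀ K' ⊆ K, K'.Nonempty → IsClosed K' →
      IsHullClosed K' → IsShiftInvariant K' → K' = K := by
  obtain ⟨K, h1, h2, h3, h4, h5⟩ := exists_minimal_nonempty_isClosed
    (fun K : Set ((G →ᵇ ℝ) → ℝ) => IsHullClosed K ∧ IsShiftInvariant K) (by
      refine fun c hc => ⟨fun m hm h => mem_sInter.2 fun s hs => (hc s hs).1 m hm fun a c' h' =>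
        h a c' fun k hk => h' k (mem_sInter.1 hk s hs), fun s m hm => mem_sInter.2 fun t ht => ?_⟩
      exact (hc t ht).2 s m (mem_sInter.1 hm t ht)) isCompact_isMean isClosed_isMean
    ⟨fun a => a 1, ⟨fun _ _ => rfl, fun _ _ => rfl⟩, fun a c h => h 1⟩
    ⟨fun m hm h => ⟨hm, fun a c hc => h a c fun k hk => hk.apply_le a c hc⟩, fun s m hm =>
      ⟨⟨fun a b => hm.linear.map_add (bshift s a) (bshift s b),
        fun c a => hm.linear.map_smul c (bshift s a)⟩,
        fun a c hc => hm.apply_le _ _ fun t => hc (s * t)⟩⟩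
  exact ⟨K, h1, h2, h3, h4.1, h4.2, fun K' a b c d e => h5 K' a b c ⟨d, e⟩⟩

/-! ### Point masses dominated by the orbit of a state -/

section Proximal

variable {X : Type*} [TopologicalSpace X] [CompactSpace X] [MulAction G X]
  [ContinuousConstSMul G X]

omit [TopologicalSpace G] [DiscreteTopology G] in
theorem IsState.bddAbove {L : C(X, ℝ) →ₗ[ℝ] ℝ} (hL : IsState L) (f : C(X, ℝ)) :
    BddAbove (range fun s : G => L (shift s f)) := by
  refine ⟨‖f‖, ?_⟩
  rintro _ ⟨s, rfl⟩
  exact hL.apply_le fun x => (abs_le.1 (f.norm_coe_le_norm (s • x))).2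

omit [TopologicalSpace G] [DiscreteTopology G] [CompactSpace X] in
-- A point mass, unlike a general state, cannot be a nontrivial average. The test function `-∑ |f -
-- f x|` vanishes at `x`, so some translate of `L` is almost zero on it, hence close to evaluation
-- at `x` on all the chosen `f` at once.
theorem mem_closure_orbit_of_le_iSup {L : C(X, ℝ) →ₗ[ℝ] ℝ} (hL : IsState L) {x : X}
    (h : ∀ f : C(X, ℝ), f x ≤ ⨆ s : G, L (shift s f)) : (fun f : C(X, ℝ) => f x) ∈
      closure (range fun s : G => fun f : C(X, ℝ) => L (shift s f)) := by
  rw [mem_closure_iff_nhds]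
  intro t ht
  rw [nhds_pi, Filter.mem_pi] at ht
  obtain ⟨I, hI, u, hu, hsub⟩ := ht
  have hball : ∀ f : C(X, ℝ), ∃ ε > 0, Metric.ball (f x) ε ⊆ u f := fun f =>
    Metric.mem_nhds_iff.1 (hu f)
  choose ε hε hεu using hball
  obtain ⟨δ, hδ, hδε⟩ : ∃ δ > 0, ∀ f ∈ hI.toFinset, δ ≤ ε f := by
    by_cases hne : hI.toFinset.Nonempty
    · exact ⟨hI.toFinset.inf' hne ε, (Finset.lt_inf'_iff hne).2 fun f _ => hε f,
        fun f hf => Finset.inf'_le _ hf⟩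
    · exact ⟨1, one_pos, fun f hf => (hne ⟨f, hf⟩).elim⟩
  let d : C(X, ℝ) → C(X, ℝ) := fun f => |f - ContinuousMap.const X (f x)|
  have hd : ∀ f, 0 ≤ d f := fun f => abs_nonneg _
  have h0 := h (-∑ f ∈ hI.toFinset, d f)
  have hz : (-∑ f ∈ hI.toFinset, d f) x = 0 := by
    simp [d, ContinuousMap.sum_apply, ContinuousMap.abs_apply]
  rw [hz] at h0
  obtain ⟨s, hs⟩ := exists_lt_of_lt_ciSup (lt_of_lt_of_le (neg_lt_zero.2 hδ) h0)
  refine ⟨_, hsub ?_, s, rfl⟩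
  intro f hf
  refine hεu f ?_
  rw [Metric.mem_ball, Real.dist_eq]
  refine lt_of_lt_of_le ?_ (hδε f (hI.mem_toFinset.2 hf))
  have h1 : |L (shift s f) - f x| ≤ L (shift s (d f)) := by
    have e1 : L (shift s f) - f x = L (shift s f - f x • 1) := by simp [hL.one]
    rw [e1, abs_le, ← map_neg]
    constructor <;> refine hL.mono fun y => ?_
    · simpa [d, ContinuousMap.abs_apply] using neg_abs_le (f (s • y) - f x)
    · simpa [d, ContinuousMap.abs_apply] using le_abs_self (f (s • y) - f x)
  have h2 : L (shift s (d f)) ≤ -L (shift s (-∑ f ∈ hI.toFinset, d f)) := by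
    rw [← map_neg]
    refine hL.mono fun y => ?_
    change d f (s • y) ≤ -(-(∑ f ∈ hI.toFinset, d f) (s • y))
    rw [neg_neg, ContinuousMap.sum_apply]
    exact Finset.single_le_sum (f := fun f => d f (s • y)) (fun g _ => hd g _)
      (hI.mem_toFinset.2 hf)
  linarith

end Proximal

/-! ### Bauer's theorem: states representing an extreme point are point masses -/

section Bauer

variable {X : Type*} [TopologicalSpace X] [CompactSpace X]
  {K : Set ((G →ᵇ ℝ) → ℝ)} {ι : X → (G →ᵇ ℝ) → ℝ}

/-- The restriction of the evaluation at `a` along a family of functionals. -/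
def evalAlong (hι : Continuous ι) (hlin : ∀ x, IsLinearMap ℝ (ι x)) :
    (G →ᵇ ℝ) →ₗ[ℝ] C(X, ℝ) where
  toFun a := ⟨fun x => ι x a, (continuous_apply a).comp hι⟩
  map_add' a b := by ext x; exact (hlin x).map_add a b
  map_smul' c a := by ext x; exact (hlin x).map_smul c a

omit [Group G] [DiscreteTopology G] [CompactSpace X] in
-- The barycentre of the state obtained from `μ` by the density `w / μ w`.
theorem mul_mem_of_isHullClosed (hK : IsHullClosed K) (hι : Continuous ι)
    (hlin : ∀ x, IsLinearMap ℝ (ι x)) (hmem : ∀ x, ι x ∈ K) {μ : C(X, ℝ) →ₗ[ℝ] ℝ}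
    (hμ : IsState μ) {w : C(X, ℝ)} (hw : 0 ≤ w) (hpos : 0 < μ w) :
    (fun a => (μ w)⁻¹ * μ (evalAlong hι hlin a * w)) ∈ K := by
  refine hK _ ⟨fun a b => ?_, fun c a => ?_⟩ fun a c hc => ?_
  · simp only [map_add, add_mul, mul_add]
  · simp only [map_smul, smul_mul_assoc, smul_eq_mul]
    ring
  · rw [inv_mul_le_iff₀ hpos]
    have : μ (evalAlong hι hlin a * w) ≤ μ (c • w) :=
      hμ.mono fun x => mul_le_mul_of_nonneg_right (hc _ (hmem x)) (hw x)
    rwa [map_smul, smul_eq_mul, mul_comm c] at this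

omit [Group G] [DiscreteTopology G] in
-- For `0 ≤ w ≤ 1` the densities `w` and `1 - w` write `e` as a convex combination of two
-- barycentres in `K`; extremality makes both equal to `e`. Degenerate weights are treated
-- separately, and general `f` by affine rescaling.
theorem map_mul_of_mem_extremePoints (hK : IsHullClosed K) (hι : Continuous ι)
    (hlin : ∀ x, IsLinearMap ℝ (ι x)) (hmem : ∀ x, ι x ∈ K) {μ : C(X, ℝ) →ₗ[ℝ] ℝ}
    (hμ : IsState μ) {e : (G →ᵇ ℝ) → ℝ} (he : e ∈ K.extremePoints ℝ)
    (hμe : ∀ a, μ (evalAlong hι hlin a) = e a) (a : G →ᵇ ℝ) (f : C(X, ℝ)) :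
    μ (evalAlong hι hlin a * f) = e a * μ f := by
  set R := evalAlong hι hlin
  have hzero : ∀ w : C(X, ℝ), 0 ≤ w → μ w = 0 → μ (R a * w) = 0 := by
    intro w hw h0
    have hb : ∀ x, |R a x| ≤ ‖R a‖ := fun x => (R a).norm_coe_le_norm x
    have h1 : μ (R a * w) ≤ μ (‖R a‖ • w) := hμ.mono fun x =>
      mul_le_mul_of_nonneg_right (abs_le.1 (hb x)).2 (hw x)
    have h2 : μ ((-‖R a‖) • w) ≤ μ (R a * w) := hμ.mono fun x =>
      mul_le_mul_of_nonneg_right (abs_le.1 (hb x)).1 (hw x)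
    rw [map_smul, h0, smul_zero] at h1 h2
    exact le_antisymm h1 h2
  have hunit : ∀ w : C(X, ℝ), 0 ≤ w → w ≤ 1 → μ (R a * w) = e a * μ w := by
    intro w hw hw1
    have hadd : μ (R a * w) + μ (R a * (1 - w)) = e a := by
      rw [← map_add, ← mul_add, add_sub_cancel, mul_one, hμe]
    have hsum : μ (1 - w) = 1 - μ w := by rw [map_sub, hμ.one]
    have hw' : 0 ≤ 1 - w := sub_nonneg.2 hw1
    rcases (hμ.nonneg w hw).eq_or_lt with h0 | h0
    · rw [hzero w hw h0.symm, ← h0, mul_zero]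
    rcases (hμ.nonneg _ hw').eq_or_lt with h1 | h1
    · have : μ w = 1 := by linarith
      rw [this, mul_one, ← hadd, hzero _ hw' h1.symm, add_zero]
    have := (mem_extremePoints.1 he).2 _ (mul_mem_of_isHullClosed hK hι hlin hmem hμ hw h0) _
      (mul_mem_of_isHullClosed hK hι hlin hmem hμ hw' h1) ⟨μ w, μ (1 - w), h0, h1, by linarith, by
        funext b
        change μ w * ((μ w)⁻¹ * μ (R b * w)) + μ (1 - w) * ((μ (1 - w))⁻¹ * μ (R b * (1 - w))) = e b
        rw [mul_inv_cancel_left₀ h0.ne', mul_inv_cancel_left₀ h1.ne', ← map_add, ← mul_add,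
          add_sub_cancel, mul_one, hμe]⟩
    have := congrFun this.1 a
    rw [← this, mul_right_comm, inv_mul_cancel₀ h0.ne', one_mul]
  obtain ⟨c, hc, hfx⟩ : ∃ c : ℝ, 0 < c ∧ ∀ x, |f x| ≤ c :=
    ⟨‖f‖ + 1, by positivity, fun x => (f.norm_coe_le_norm x).trans (by simp)⟩
  -- Since `|f| ≤ c`, this affine image of `f` takes values in `[0, 1]`.
  have h := hunit ((2 * c)⁻¹ • (f + c • 1))
    (fun x => by
      have := (abs_le.1 (hfx x)).1
      change 0 ≤ (2 * c)⁻¹ * (f x + c * 1)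
      exact mul_nonneg (by positivity) (by linarith))
    (fun x => by
      have := (abs_le.1 (hfx x)).2
      change (2 * c)⁻¹ * (f x + c * 1) ≤ 1
      rw [inv_mul_le_iff₀ (by positivity)]
      linarith)
  have e1 : μ (R a * (2 * c)⁻¹ • (f + c • 1)) = (2 * c)⁻¹ * (μ (R a * f) + c * e a) := by
    rw [mul_smul_comm, map_smul, mul_add (R a), map_add, mul_smul_comm, mul_one, map_smul, hμe]
    rfl
  have e2 : μ ((2 * c)⁻¹ • (f + c • 1)) = (2 * c)⁻¹ * (μ f + c) := by
    rw [map_smul, map_add, map_smul, hμ.one, smul_eq_mul, smul_eq_mul, mul_one]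
  rw [e1, e2] at h
  have h2 : (2 * c)⁻¹ ≠ 0 := by positivity
  have h3 : (2 * c)⁻¹ * μ (R a * f) = (2 * c)⁻¹ * (e a * μ f) := by linear_combination h
  exact mul_left_cancel₀ h2 h3

omit [Group G] [DiscreteTopology G] in
-- The functions on which `μ` is multiplicative form a closed subalgebra containing the coordinate
-- functions, which separate points. By Stone–Weierstrass `μ` is a character of `C(X, ℝ)`.
theorem exists_eq_eval_of_mem_extremePoints [T2Space X] (hK : IsHullClosed K) (hι : Continuous ι)
    (hinj : Function.Injective ι)
    (hlin : ∀ x, IsLinearMap ℝ (ι x)) (hmem : ∀ x, ι x ∈ K) {μ : C(X, ℝ) →ₗ[ℝ] ℝ}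
    (hμ : IsState μ) {e : (G →ᵇ ℝ) → ℝ} (he : e ∈ K.extremePoints ℝ)
    (hμe : ∀ a, μ (evalAlong hι hlin a) = e a) : ∃ x, ∀ f, μ f = f x := by
  have hμc : Continuous μ := by
    have := (μ.mkContinuous 1 fun f => by simpa using hμ.abs_apply_le f).continuous
    exact this
  let A : Subalgebra ℝ C(X, ℝ) :=
    { carrier := {f | ∀ g, μ (f * g) = μ f * μ g}
      mul_mem' := fun {f f'} hf hf' g => by
        rw [mul_assoc, hf, hf', hf, mul_assoc]
      add_mem' := fun {f f'} hf hf' g => by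
        rw [add_mul, map_add, hf, hf', map_add, add_mul]
      algebraMap_mem' := fun r g => by
        rw [Algebra.algebraMap_eq_smul_one, smul_mul_assoc, one_mul, map_smul, map_smul, hμ.one,
          smul_eq_mul, smul_eq_mul, mul_one] }
  have hAc : IsClosed (A : Set C(X, ℝ)) := by
    have : (A : Set C(X, ℝ)) = ⋂ g, {f | μ (f * g) = μ f * μ g} := by
      ext f
      simp [A]
    rw [this]
    exact isClosed_iInter fun g => isClosed_eq (hμc.comp (continuous_mul_const g))
      (hμc.mul continuous_const)
  have hsep : A.SeparatesPoints := by
    intro x y hxy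
    obtain ⟨a, ha⟩ := Function.ne_iff.1 (hinj.ne hxy)
    refine ⟨_, ⟨evalAlong hι hlin a, fun g => ?_, rfl⟩, ha⟩
    rw [hμe]
    exact map_mul_of_mem_extremePoints hK hι hlin hmem hμ he hμe a g
  have htop := ContinuousMap.subalgebra_topologicalClosure_eq_top_of_separatesPoints A hsep
  have hall : ∀ f g, μ (f * g) = μ f * μ g := by
    intro f
    have : f ∈ A.topologicalClosure := htop ▸ Algebra.mem_top
    have h2 : f ∈ closure (A : Set C(X, ℝ)) := this
    rw [hAc.closure_eq] at h2
    exact h2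
  let χ : C(X, ℝ) →ₐ[ℝ] ℝ := AlgHom.ofLinearMap μ hμ.one hall
  obtain ⟨x, hx⟩ := (WeakDual.CharacterSpace.continuousMapEval_bijective X ℝ).2
    (WeakDual.CharacterSpace.equivAlgHom.symm χ)
  refine ⟨x, fun f => ?_⟩
  exact (congrArg (fun φ : WeakDual.characterSpace ℝ C(X, ℝ) => φ f) hx).symm

end Bauer

/-! ### Strong proximality and universality from means -/

section Boundary

variable {X : Type*} [TopologicalSpace X] [CompactSpace X] [T2Space X] [MulAction G X]
  [ContinuousConstSMul G X] {ι : X → (G →ᵇ ℝ) → ℝ}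

theorem isStronglyProximal_of_minimal_means [Nonempty X] {K : Set ((G →ᵇ ℝ) → ℝ)}
    (hKm : K ⊆ {m | IsMean m}) (hKne : K.Nonempty) (hKc : IsClosed K)
    (hK : IsHullClosed K) (hKi : IsShiftInvariant K)
    (hmin : ∀ K' ⊆ K, K'.Nonempty → IsClosed K' → IsHullClosed K' → IsShiftInvariant K' → K' = K)
    (hι : Continuous ι) (hinj : Function.Injective ι) (hmem : ∀ x, ι x ∈ K)
    (hequiv : ∀ (s : G) x a, ι (s • x) a = ι x (bshift s a)) : IsStronglyProximal G X := by
  rw [isStronglyProximal_iff]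
  intro L hL
  have hlin : ∀ x, IsLinearMap ℝ (ι x) := fun x => (hKm (hmem x)).linear
  set R := evalAlong hι hlin with hR
  have hRs : ∀ s a, R (bshift s a) = shift s (R a) := fun s a => by
    ext x
    exact (hequiv s x a).symm
  -- `N` is the support function of the orbit of `L`: the states below `N` are its closed convex
  -- hull.
  let N : C(X, ℝ) → ℝ := fun f => ⨆ s : G, L (shift s f)
  have hle : ∀ s f, L (shift s f) ≤ N f := fun s f => le_ciSup (hL.bddAbove f) s
  have hN : ∀ f c, (∀ s : G, L (shift s f) ≤ c) → N f ≤ c := fun f c h => ciSup_le h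
  -- The functionals satisfying the bound form an admissible subset of `K`, nonempty because it
  -- contains the barycentre of `L`; minimality makes it all of `K`.
  have hNK : ∀ m ∈ K, ∀ a, m a ≤ N (R a) := by
    have : {m | m ∈ K ∧ ∀ a, m a ≤ N (R a)} = K := by
      refine hmin _ (fun m hm => hm.1) ?_ ?_ ?_ ?_
      · refine ⟨fun a => L (R a), hK _ ⟨fun a b => by simp, fun c a => by simp⟩ fun a c h => ?_,
          fun a => ?_⟩
        · exact hL.apply_le fun x => h _ (hmem x)
        · simpa using hle 1 (R a)
      · rw [ofPred_and, ofPred_forall]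
        exact hKc.inter (isClosed_iInter fun a => isClosed_le (continuous_apply a) continuous_const)
      · refine fun m hm h => ⟨hK m hm fun a c hc => h a c fun k hk => hc k hk.1, fun a => ?_⟩
        exact h a _ fun k hk => hk.2 a
      · refine fun s m hm => ⟨hKi s m hm.1, fun a => (hm.2 _).trans ?_⟩
        rw [hRs]
        refine hN _ _ fun t => ?_
        rw [← shift_mul]
        exact hle _ _
    intro m hm
    rw [← this] at hm
    exact hm.2
  obtain ⟨e, he⟩ := (isCompact_isMean.of_isClosed_subset hKc hKm).extremePoints_nonempty hKne
  have heK : e ∈ K := he.1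
  let eL : (G →ᵇ ℝ) →ₗ[ℝ] ℝ := (hKm heK).linear.mk' e
  obtain ⟨σ, hσ⟩ := R.rangeRestrict.exists_rightInverse_of_surjective R.range_rangeRestrict
  have hσ' : ∀ f : LinearMap.range R, R (σ f) = f := fun f =>
    congrArg Subtype.val (LinearMap.congr_fun hσ f)
  -- Hahn–Banach extends `e` from the coordinate functions to a state below `N`. The choice of
  -- preimage by `σ` is harmless: `e ≤ N ∘ R` makes `e` vanish on the kernel of `R`.
  obtain ⟨μ, hμ1, hμ2⟩ := exists_extension_of_le_sublinear
    ⟨LinearMap.range R, eL ∘ₗ σ⟩ N (fun c hc f => by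
      have : ∀ s : G, L (shift s (c • f)) = c * L (shift s f) := fun s => map_smul L c (shift s f)
      simp only [N, this]
      rw [Real.mul_iSup_of_nonneg hc.le])
    (fun f g => hN _ _ fun s => (map_add L (shift s f) (shift s g)).le.trans
      (add_le_add (hle s f) (hle s g)))
    (fun f => (hNK e heK (σ f)).trans_eq (congrArg N (hσ' f)))
  have hμs : IsState μ := IsState.of_apply_le fun f c hf =>
    (hμ2 f).trans (hN _ _ fun s => hL.apply_le fun x => hf (s • x))
  have hμe : ∀ a, μ (R a) = e a := by
    intro a
    have h1 : μ (R a) = e (σ ⟨R a, a, rfl⟩) := hμ1 ⟨R a, a, rfl⟩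
    have hN0 : N 0 ≤ 0 := hN _ _ fun s => hL.apply_le fun x => le_rfl
    have h2 : ∀ b, R b = 0 → e b ≤ 0 := fun b hb => (hNK e heK b).trans (hb ▸ hN0)
    have h3 : R (σ ⟨R a, a, rfl⟩ - a) = 0 := by rw [map_sub, hσ', sub_self]
    have h4 := h2 _ h3
    have h5 := h2 (a - σ ⟨R a, a, rfl⟩) (by rw [← neg_sub, map_neg, h3, neg_zero])
    rw [(hKm heK).linear.map_sub] at h4 h5
    linarith
  obtain ⟨x, hx⟩ := exists_eq_eval_of_mem_extremePoints hK hι hinj hlin hmem hμs he hμe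
  exact ⟨x, mem_closure_orbit_of_le_iSup hL fun f => hx f ▸ hμ2 f⟩

omit [T2Space X] in
-- The orbit map of `y₀` turns each mean into a state on `C(Y, ℝ)`. The points whose state is a
-- point mass form a closed invariant set, so by minimality one such point suffices.
theorem exists_factor_map_of_means [MulAction.IsMinimal G X] [Nonempty X] (hι : Continuous ι)
    (hmean : ∀ x, IsMean (ι x)) (hequiv : ∀ (s : G) x a, ι (s • x) a = ι x (bshift s a))
    {Y : Type*} [TopologicalSpace Y] [CompactSpace Y] [T2Space Y] [MulAction G Y]
    [ContinuousConstSMul G Y] (hY : IsGBoundary G Y) :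
    ∃ φ : X → Y, Continuous φ ∧ Function.Surjective φ ∧
      ∀ (s : G) (x : X), φ (s • x) = s • φ x := by
  have : MulAction.IsMinimal G Y := hY.minimal
  obtain ⟨y₀⟩ := hY.nonempty
  let orb : C(Y, ℝ) → (G →ᵇ ℝ) := fun f => (BoundedContinuousFunction.mkOfCompact f).compContinuous
    ⟨fun g => g • y₀, continuous_of_discreteTopology⟩
  have horb : ∀ s f, orb (shift s f) = bshift s (orb f) := fun s f => by
    ext g
    simp [orb, mul_smul]
  let Λ : X → C(Y, ℝ) → ℝ := fun x f => ι x (orb f)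
  let ev : Y → C(Y, ℝ) → ℝ := fun y f => f y
  have hΛ : Continuous Λ := continuous_pi fun f => (continuous_apply _).comp hι
  have hev : Continuous ev := continuous_pi fun f => f.continuous
  have hevinj : Function.Injective ev := by
    intro y z hyz
    by_contra hne
    obtain ⟨f, hf0, hf1, -⟩ := exists_continuous_zero_one_of_isClosed
      (isClosed_singleton (x := y)) (isClosed_singleton (x := z)) (by simpa using hne)
    have h0 : f y = 0 := hf0 rfl
    have h1 : f z = 1 := hf1 rfl
    have h2 : f y = f z := congrFun hyz f
    exact zero_ne_one (h0.symm.trans (h2.trans h1))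
  have hemb := hev.isClosedEmbedding hevinj
  have hΛs : ∀ (s : G) x f, Λ (s • x) f = Λ x (shift s f) := fun s x f => by
    simp only [Λ, hequiv, horb]
  have hevs : ∀ (s : G) y f, ev (s • y) f = ev y (shift s f) := fun _ _ _ => rfl
  have hne : (Λ ⁻¹' range ev).Nonempty := by
    obtain ⟨x⟩ := ‹Nonempty X›
    let L : C(Y, ℝ) →ₗ[ℝ] ℝ :=
      { toFun := Λ x
        map_add' := fun f g => (hmean x).linear.map_add (orb f) (orb g)
        map_smul' := fun c f => (hmean x).linear.map_smul c (orb f) }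
    have hL : IsState L := IsState.of_apply_le fun f c hf =>
      (hmean x).apply_le _ _ fun t => hf (t • y₀)
    have h := hY.mem_closure_orbit hL y₀
    -- The range of `Λ` is compact and contains the orbit of `L`, hence also the point mass in the
    -- closure of that orbit.
    have hcl : IsClosed (range Λ) := (isCompact_range hΛ).isClosed
    have : (fun f : C(Y, ℝ) => f y₀) ∈ range Λ := by
      refine hcl.closure_subset_iff.2 ?_ h
      rintro _ ⟨s, rfl⟩
      exact ⟨s • x, funext fun f => hΛs s x f⟩
    obtain ⟨x', hx'⟩ := this
    exact ⟨x', y₀, hx'.symm⟩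
  have huniv : Λ ⁻¹' range ev = univ := by
    refine ((isMinimal_iff_isClosed_smul_invariant (M := G) (α := X)).1 inferInstance _
      (hemb.isClosed_range.preimage hΛ) ?_).resolve_left hne.ne_empty
    rintro s _ ⟨x, ⟨y, hy⟩, rfl⟩
    refine ⟨s • y, funext fun f => ?_⟩
    rw [hevs, hy, ← hΛs]
  have hall : ∀ x, ∃ y, ev y = Λ x := fun x => by
    have : x ∈ Λ ⁻¹' range ev := huniv ▸ mem_univ x
    exact this
  choose φ hφ using hall
  have hφs : ∀ (s : G) (x : X), φ (s • x) = s • φ x := fun s x => hevinj (funext fun f => by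
    rw [hφ, hΛs, hevs, hφ])
  have hφc : Continuous φ := by
    rw [hemb.isInducing.continuous_iff]
    exact hΛ.congr fun x => (hφ x).symm
  refine ⟨φ, hφc, ?_, hφs⟩
  rw [← range_eq_univ]
  refine ((isMinimal_iff_isClosed_smul_invariant (M := G) (α := Y)).1 inferInstance _
    (isCompact_range hφc).isClosed ?_).resolve_left (range_nonempty φ).ne_empty
  rintro s _ ⟨_, ⟨x, rfl⟩, rfl⟩
  exact ⟨s • x, hφs s x⟩

end Boundary

variable (G) in
theorem exists_isFurstenbergBoundary_means :
    ∃ (X : Type u) (_ : TopologicalSpace X) (_ : CompactSpace X) (_ : T2Space X)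
      (_ : MulAction G X) (_ : ContinuousConstSMul G X), IsFurstenbergBoundary G X ∧
      ∃ m : X → (G →ᵇ ℝ) → ℝ, (∀ x, IsMean (m x)) ∧
        ∀ (s : G) x a, m (s • x) a = m x (bshift s a) := by
  obtain ⟨K, hKm, hKne, hKc, hK, hKi, hmin⟩ := exists_minimal_means (G := G)
  obtain ⟨S, hSK, hSne, hSc, hSi, hSmin⟩ := exists_minimal_nonempty_isClosed
    (IsShiftInvariant (G := G)) (fun c hc s m hm => mem_sInter.2 fun t ht =>
      hc t ht s m (mem_sInter.1 hm t ht)) (isCompact_isMean.of_isClosed_subset hKc hKm) hKc hKne hKi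
  let act : MulAction G S :=
    { smul := fun s m => ⟨fun a => m.1 (bshift s a), hSi s m.1 m.2⟩
      one_smul := fun m => Subtype.ext (funext fun a => congrArg m.1 (by ext t; simp))
      mul_smul := fun s t m => Subtype.ext (funext fun a => congrArg m.1 (bshift_mul s t a)) }
  have hcs : CompactSpace S := isCompact_iff_compactSpace.1
    (isCompact_isMean.of_isClosed_subset hSc (hSK.trans hKm))
  have hcont : ContinuousConstSMul G S := ⟨fun s => by
    rw [Topology.IsInducing.subtypeVal.continuous_iff]
    exact continuous_pi fun a => (continuous_apply (bshift s a)).comp continuous_subtype_val⟩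
  have hne : Nonempty S := hSne.to_subtype
  have hequiv : ∀ (s : G) (x : S) a, (s • x).1 a = x.1 (bshift s a) := fun _ _ _ => rfl
  have hminS : MulAction.IsMinimal G S := by
    rw [isMinimal_iff_isClosed_smul_invariant]
    intro T hT hTi
    rcases T.eq_empty_or_nonempty with h | h
    · exact Or.inl h
    · right
      have := hSmin (Set.image Subtype.val T) (by rintro _ ⟨x, -, rfl⟩; exact x.2) (h.image _)
        (hSc.isClosedEmbedding_subtypeVal.isClosedMap T hT) (by
          rintro s _ ⟨x, hx, rfl⟩
          exact ⟨s • x, hTi s ⟨x, hx, rfl⟩, rfl⟩)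
      refine eq_univ_of_forall fun x => ?_
      have hx : x.1 ∈ Set.image Subtype.val T := this.symm ▸ x.2
      obtain ⟨y, hy, hxy⟩ := hx
      exact Subtype.ext hxy ▸ hy
  refine ⟨S, inferInstance, hcs, inferInstance, act, hcont, ⟨⟨hne, hminS, ?_⟩, ?_⟩,
    Subtype.val, fun x => hKm (hSK x.2), hequiv⟩
  · exact isStronglyProximal_of_minimal_means hKm hKne hKc hK hKi hmin continuous_subtype_val
      Subtype.val_injective (fun x => hSK x.2) hequiv
  · intro Y _ _ _ _ _ hY
    exact exists_factor_map_of_means continuous_subtype_val (fun x => hKm (hSK x.2)) hequiv hY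

end

noncomputable section

/-! ### Covariant representations -/

instance Prod.instCStarAlgebra {A A' : Type*} [CStarAlgebra A] [CStarAlgebra A'] :
    CStarAlgebra (A × A') where

/-- A covariant representation of a `G`-space `B` in a C*-algebra. -/
structure CovRep (G B A : Type*) [Group G] [TopologicalSpace B] [MulAction G B]
    [ContinuousConstSMul G B] [CStarAlgebra A] where
  /-- the representation of the functions -/
  π : C(B, ℂ) →⋆ₐ[ℂ] A
  /-- the representation of the group -/
  u : G →* A
  star_u : ∀ s, star (u s) = u s⁻¹
  cov : ∀ s f, u s * π (shift s f) = π f * u s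

namespace CovRep

variable {G B A : Type*} [Group G] [TopologicalSpace B] [MulAction G B]
    [ContinuousConstSMul G B] [CStarAlgebra A] (R : CovRep G B A)

/-- The operator `∑ s, π (c s) u s`. -/
def ev : (G →₀ C(B, ℂ)) →ₗ[ℂ] A :=
  Finsupp.lsum ℂ fun s => (LinearMap.mulRight ℂ (R.u s)) ∘ₗ R.π.toAlgHom.toLinearMap

theorem ev_apply (c : G →₀ C(B, ℂ)) : R.ev c = c.sum fun s f => R.π f * R.u s := rfl

@[simp]
theorem ev_single (s : G) (f : C(B, ℂ)) : R.ev (Finsupp.single s f) = R.π f * R.u s := by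
  simp [ev_apply]

theorem u_mul_π (s : G) (f : C(B, ℂ)) : R.u s * R.π f = R.π (shift s⁻¹ f) * R.u s := by
  rw [← R.cov, ← shift_mul, inv_mul_cancel, shift_one]

theorem u_inv_mul_self (s : G) : R.u s⁻¹ * R.u s = 1 := by
  rw [← map_mul, inv_mul_cancel, map_one]

theorem norm_u_le [Nontrivial A] (s : G) : ‖R.u s‖ ≤ 1 := by
  have h : ‖star (R.u s) * R.u s‖ = ‖R.u s‖ * ‖R.u s‖ := CStarRing.norm_star_mul_self
  rw [R.star_u, R.u_inv_mul_self, CStarRing.norm_one] at h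
  nlinarith [norm_nonneg (R.u s)]

theorem ev_mem_of_mem {S : Submodule ℂ A} (h : ∀ s f, R.π f * R.u s ∈ S) (c : G →₀ C(B, ℂ)) :
    R.ev c ∈ S :=
  Submodule.sum_mem _ fun s _ => h s (c s)

/-- The *-algebra of the operators `∑ s, π (c s) u s`. -/
def alg : StarSubalgebra ℂ A where
  carrier := range R.ev
  mul_mem' := by
    rintro _ _ ⟨c, rfl⟩ ⟨d, rfl⟩
    have key : ∀ s f t g, R.π f * R.u s * (R.π g * R.u t) ∈ LinearMap.range R.ev :=
      fun s f t g => ⟨Finsupp.single (s * t) (f * shift s⁻¹ g), by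
        rw [ev_single, map_mul, map_mul, mul_assoc, mul_assoc, ← mul_assoc (R.u s), u_mul_π]
        simp only [mul_assoc]⟩
    have h1 : ∀ s f d, R.π f * R.u s * R.ev d ∈ LinearMap.range R.ev := fun s f d =>
      R.ev_mem_of_mem (S := (LinearMap.range R.ev).comap (LinearMap.mulLeft ℂ (R.π f * R.u s)))
        (fun t g => key s f t g) d
    exact R.ev_mem_of_mem (S := (LinearMap.range R.ev).comap (LinearMap.mulRight ℂ (R.ev d)))
      (fun s f => h1 s f d) c
  add_mem' := by
    rintro _ _ ⟨c, rfl⟩ ⟨d, rfl⟩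
    exact ⟨c + d, map_add _ _ _⟩
  algebraMap_mem' r := ⟨Finsupp.single 1 (algebraMap ℂ _ r), by
    rw [ev_single, map_one, mul_one, AlgHomClass.commutes]⟩
  star_mem' := by
    rintro _ ⟨c, rfl⟩
    have key : ∀ s f, star (R.π f * R.u s) ∈ LinearMap.range R.ev := fun s f =>
      ⟨Finsupp.single s⁻¹ (shift s (star f)), by
        rw [ev_single, star_mul, R.star_u, ← map_star, u_mul_π, inv_inv]⟩
    have : star (R.ev c) ∈ LinearMap.range R.ev := by
      rw [ev_apply, Finsupp.sum, star_sum]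
      exact Submodule.sum_mem _ fun s _ => key s (c s)
    exact this

theorem π_mem_alg (f : C(B, ℂ)) : R.π f ∈ R.alg := ⟨Finsupp.single 1 f, by simp⟩

theorem u_mem_alg (s : G) : R.u s ∈ R.alg := ⟨Finsupp.single s 1, by simp⟩

theorem adjoin_eq_alg : StarAlgebra.adjoin ℂ (range R.π ∪ range R.u) = R.alg := by
  refine le_antisymm (StarAlgebra.adjoin_le ?_) ?_
  · rintro _ (⟨f, rfl⟩ | ⟨s, rfl⟩)
    exacts [R.π_mem_alg f, R.u_mem_alg s]
  · rintro _ ⟨c, rfl⟩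
    exact Submodule.sum_mem (Subalgebra.toSubmodule (StarAlgebra.adjoin ℂ
      (range R.π ∪ range R.u)).toSubalgebra) fun s _ =>
      (StarAlgebra.adjoin ℂ (range R.π ∪ range R.u)).mul_mem
        (StarAlgebra.subset_adjoin ℂ _ (Or.inl ⟨_, rfl⟩))
        (StarAlgebra.subset_adjoin ℂ _ (Or.inr ⟨s, rfl⟩))

/-- The closed *-algebra of a covariant representation. -/
def cstar : StarSubalgebra ℂ A := R.alg.topologicalClosure

theorem mem_cstar {a : A} : a ∈ R.cstar ↔ a ∈ closure (range R.ev) := Iff.rfl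

theorem ev_mem_cstar (c : G →₀ C(B, ℂ)) : R.ev c ∈ R.cstar := subset_closure ⟨c, rfl⟩

theorem isClosed_cstar : IsClosed (R.cstar : Set A) :=
  StarSubalgebra.isClosed_topologicalClosure _

/-- The pair of two covariant representations. -/
def prod {A' : Type*} [CStarAlgebra A'] (R' : CovRep G B A') : CovRep G B (A × A') where
  π := R.π.prod R'.π
  u := R.u.prod R'.u
  star_u s := Prod.ext (R.star_u s) (R'.star_u s)
  cov s f := Prod.ext (R.cov s f) (R'.cov s f)

theorem prod_ev {A' : Type*} [CStarAlgebra A'] (R' : CovRep G B A') (c : G →₀ C(B, ℂ)) :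
    (R.prod R').ev c = (R.ev c, R'.ev c) := by
  simp only [ev_apply, Finsupp.sum]
  exact Prod.ext (Prod.fst_sum ..) (Prod.snd_sum ..)

end CovRep

/-! ### Permutation representations on `ℓ²(ι)` -/

theorem star_permOp {ι : Type*} (e : Equiv.Perm ι) : star (permOp e) = permOp e.symm := by
  rw [ContinuousLinearMap.star_eq_adjoint]
  symm
  rw [ContinuousLinearMap.eq_adjoint_iff]
  intro x y
  rw [lp.inner_eq_tsum, lp.inner_eq_tsum, ← e.symm.tsum_eq]
  exact tsum_congr fun i => by simp

theorem star_mulOp {ι : Type*} (φ : ι → ℂ) (C : ℝ) (h : ∀ i, ‖φ i‖ ≤ C) :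
    star (mulOp φ C h) = mulOp (fun i => star (φ i)) C (fun i => by simpa using h i) := by
  rw [ContinuousLinearMap.star_eq_adjoint]
  symm
  rw [ContinuousLinearMap.eq_adjoint_iff]
  intro x y
  rw [lp.inner_eq_tsum, lp.inner_eq_tsum]
  exact tsum_congr fun i => by
    simp only [mulOp_apply, RCLike.inner_apply, map_mul, RCLike.star_def, RCLike.conj_conj]
    ring

/-- The covariant representation of `B` on `ℓ²(ι)` given by an action `κ` on `ι` and an
equivariant map `j : ι → B`. -/
def permRep {G B ι : Type*} [Group G] [TopologicalSpace B] [CompactSpace B] [MulAction G B]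
    [ContinuousConstSMul G B] (κ : G →* Equiv.Perm ι) (j : ι → B)
    (hj : ∀ s i, j (κ s i) = s • j i) : CovRep G B (EllTwo ι →L[ℂ] EllTwo ι) where
  π :=
    { toFun := fun f => mulOp (fun i => f (j i)) ‖f‖ (fun i => f.norm_coe_le_norm (j i))
      map_one' := by
        ext ξ i
        simp
      map_mul' := fun f g => by
        ext ξ i
        simp [mul_assoc]
      map_zero' := by
        ext ξ i
        simp
      map_add' := fun f g => by
        ext ξ i
        simp [add_mul]
      commutes' := fun r => by
        ext ξ i
        simp [Algebra.algebraMap_eq_smul_one]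
      map_star' := fun f => by
        rw [star_mulOp]
        ext ξ i
        simp }
  u :=
    { toFun := fun s => permOp (κ s)
      map_one' := by
        rw [map_one]
        rfl
      map_mul' := fun s t => by
        rw [map_mul]
        rfl }
  star_u s := by
    change star (permOp (κ s)) = permOp (κ s⁻¹)
    rw [star_permOp, map_inv]
    rfl
  cov s f := by
    ext ξ i
    change f (s • j ((κ s).symm i)) * ξ ((κ s).symm i) = f (j i) * ξ ((κ s).symm i)
    rw [← hj, Equiv.apply_symm_apply]

section PermRep

variable {G B ι : Type*} [Group G] [TopologicalSpace B] [CompactSpace B] [MulAction G B]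
    [ContinuousConstSMul G B] (κ : G →* Equiv.Perm ι) (j : ι → B)
    (hj : ∀ s i, j (κ s i) = s • j i)

@[simp]
theorem permRep_π_apply (f : C(B, ℂ)) (ξ : EllTwo ι) (i : ι) :
    (permRep κ j hj).π f ξ i = f (j i) * ξ i := rfl

@[simp]
theorem permRep_u_apply (s : G) (ξ : EllTwo ι) (i : ι) :
    (permRep κ j hj).u s ξ i = ξ (κ s⁻¹ i) := by
  rw [map_inv]
  rfl

theorem permRep_ev_apply (c : G →₀ C(B, ℂ)) (ξ : EllTwo ι) (i : ι) :
    (permRep κ j hj).ev c ξ i = ∑ s ∈ c.support, c s (j i) * ξ (κ s⁻¹ i) := by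
  rw [CovRep.ev_apply, Finsupp.sum, sum_apply, lp.coeFn_sum, Finset.sum_apply]
  exact Finset.sum_congr rfl fun s _ => by
    rw [mul_apply_eq_comp, permRep_π_apply, permRep_u_apply]

end PermRep

end

noncomputable section

/-! ### Moving functionals to point evaluations -/

theorem norm_add_sq_le_of_star_mul_eq_zero {A : Type*} [CStarAlgebra A] {a b : A}
    (h : star a * b = 0) : ‖a + b‖ ^ 2 ≤ ‖a‖ ^ 2 + ‖b‖ ^ 2 := by
  have h' : star b * a = 0 := by
    rw [← star_star a, ← star_mul, h, star_zero]
  rw [sq, sq, sq, ← CStarRing.norm_star_mul_self, ← CStarRing.norm_star_mul_self,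
    ← CStarRing.norm_star_mul_self, star_add, add_mul, mul_add, mul_add, h, h', add_zero, zero_add]
  exact norm_add_le _ _

theorem norm_add_sq_le_of_mul_star_eq_zero {A : Type*} [CStarAlgebra A] {a b : A}
    (h : a * star b = 0) : ‖a + b‖ ^ 2 ≤ ‖a‖ ^ 2 + ‖b‖ ^ 2 := by
  have := norm_add_sq_le_of_star_mul_eq_zero (a := star a) (b := star b) (by rwa [star_star])
  rwa [← star_add, norm_star, norm_star, norm_star] at this

/-- A first-order perturbation: if `ψ b ≠ 0`, moving from `a` a little along `b` raises `ψ`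
linearly, whereas the norm grows only quadratically. This replaces Cauchy–Schwarz for states. -/
theorem apply_eq_zero_of_norm_add_sq_le {A : Type*} [CStarAlgebra A] {ψ : A →L[ℂ] ℂ}
    (hψ : ‖ψ‖ ≤ 1) {a b : A} (h1 : (ψ a).re = 1)
    (h : ∀ z : ℂ, ‖a + z • b‖ ^ 2 ≤ 1 + ‖z • b‖ ^ 2) : ψ b = 0 := by
  by_contra hne
  have hw : 0 < ‖ψ b‖ ^ 2 := by positivity
  set t : ℝ := (‖b‖ ^ 2 + 1)⁻¹
  have ht : 0 < t := by positivity
  have htb : t * ‖b‖ ^ 2 < 1 := by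
    rw [inv_mul_lt_iff₀ (by positivity)]
    linarith
  have hz := h ((t : ℂ) * star (ψ b))
  have e1 : (ψ (a + ((t : ℂ) * star (ψ b)) • b)).re = 1 + t * ‖ψ b‖ ^ 2 := by
    rw [map_add, map_smul, Complex.add_re, h1, smul_eq_mul, mul_assoc, Complex.re_ofReal_mul,
      ← Complex.normSq_eq_norm_sq, RCLike.star_def, ← Complex.normSq_eq_conj_mul_self,
      Complex.ofReal_re]
  have e2 : ‖((t : ℂ) * star (ψ b)) • b‖ ^ 2 = t ^ 2 * ‖ψ b‖ ^ 2 * ‖b‖ ^ 2 := by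
    rw [norm_smul, norm_mul, norm_star, Complex.norm_real, Real.norm_of_nonneg ht.le]
    ring
  have h3 : 1 + t * ‖ψ b‖ ^ 2 ≤ ‖a + ((t : ℂ) * star (ψ b)) • b‖ := by
    rw [← e1]
    exact (Complex.re_le_norm _).trans ((ψ.le_of_opNorm_le hψ _).trans_eq (one_mul _))
  have h4 : (1 + t * ‖ψ b‖ ^ 2) ^ 2 ≤ 1 + t ^ 2 * ‖ψ b‖ ^ 2 * ‖b‖ ^ 2 := by
    rw [← e2]
    exact (pow_le_pow_left₀ (by positivity) h3 2).trans hz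
  have h5 : t * ‖ψ b‖ ^ 2 * (t * ‖b‖ ^ 2) < t * ‖ψ b‖ ^ 2 * 1 :=
    mul_lt_mul_of_pos_left htb (by positivity)
  nlinarith [sq_nonneg (t * ‖ψ b‖ ^ 2)]

section

variable {X : Type*} [TopologicalSpace X]

/-- A real function as a complex function. -/
def toComplex (f : C(X, ℝ)) : C(X, ℂ) := ⟨fun x => (f x : ℂ), by fun_prop⟩

@[simp]
theorem toComplex_apply (f : C(X, ℝ)) (x : X) : toComplex f x = (f x : ℂ) := rfl

theorem eq_eval_mul_of_local [CompactSpace X] (η : C(X, ℂ) →ₗ[ℂ] ℂ) (C : ℝ)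
    (hb : ∀ f, ‖η f‖ ≤ C * ‖f‖) (x : X)
    (h0 : ∀ (f : C(X, ℂ)) (g : C(X, ℝ)), 0 ≤ g → g ≤ 1 → g x = 1 → (toComplex g) * f = 0 → η f = 0)
    (f : C(X, ℂ)) : η f = f x * η 1 := by
  have key : ∀ f : C(X, ℂ), f x = 0 → η f = 0 := by
    intro f hf
    have hC : 0 ≤ |C| := abs_nonneg C
    have hδ : ∀ δ > 0, ‖η f‖ ≤ |C| * δ := by
      intro δ hδ
      -- The cutoff `h` is `0` where `‖f‖ ≤ δ / 2` and `1` where `‖f‖ ≥ δ`, while `g` lives where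
      -- `‖f‖ < δ / 2`. Thus `g * h = 0`, and `f * (1 - h)` has norm at most `δ`.
      let h : C(X, ℝ) := ⟨fun y => min 1 (max 0 (2 * ‖f y‖ / δ - 1)), by fun_prop⟩
      let g : C(X, ℝ) := ⟨fun y => max 0 (1 - 2 * ‖f y‖ / δ), by fun_prop⟩
      have hz : η (f * toComplex h) = 0 := by
        refine h0 _ g (fun y => le_max_left _ _) (fun y => ?_) ?_ ?_
        · exact max_le zero_le_one (sub_le_self _ (by positivity))
        · simp [g, hf]
        · ext y
          simp only [ContinuousMap.mul_apply, toComplex_apply, ContinuousMap.zero_apply]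
          rcases le_total (2 * ‖f y‖ / δ) 1 with hy | hy
          · have : h y = 0 := by
              change min 1 (max 0 (2 * ‖f y‖ / δ - 1)) = 0
              rw [max_eq_left (by linarith), min_eq_right zero_le_one]
            simp [this]
          · have : g y = 0 := max_eq_left (by linarith)
            simp [this]
      have e : η f = η (f * (1 - toComplex h)) := by
        rw [mul_sub, map_sub, hz, mul_one, sub_zero]
      rw [e]
      refine (hb _).trans (mul_le_mul (le_abs_self C) ?_ (norm_nonneg _) hC)
      rw [ContinuousMap.norm_le _ hδ.le]
      intro y
      have hh0 : 0 ≤ h y := le_min zero_le_one (le_max_left _ _)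
      have hh1 : h y ≤ 1 := min_le_left _ _
      have e2 : ‖(1 : ℂ) - (h y : ℂ)‖ = 1 - h y := by
        rw [← Complex.ofReal_one, ← Complex.ofReal_sub, Complex.norm_real,
          Real.norm_of_nonneg (by linarith)]
      simp only [ContinuousMap.mul_apply, ContinuousMap.sub_apply, ContinuousMap.one_apply,
        toComplex_apply, norm_mul, e2]
      rcases le_total (‖f y‖) δ with hy | hy
      · nlinarith [norm_nonneg (f y)]
      · have : h y = 1 := by
          refine min_eq_left ((le_max_right _ _).trans' ?_)
          rw [le_sub_iff_add_le, le_div_iff₀ hδ]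
          linarith
        rw [this, sub_self, mul_zero]
        exact hδ.le
    by_contra hne
    have hpos : 0 < ‖η f‖ := norm_pos_iff.2 hne
    have := hδ (‖η f‖ / (2 * (|C| + 1))) (by positivity)
    have h2 : |C| * (‖η f‖ / (2 * (|C| + 1))) ≤ ‖η f‖ / 2 := by
      rw [mul_div_assoc', div_le_div_iff₀ (by positivity) (by positivity)]
      nlinarith
    linarith
  have := key (f - f x • 1) (by simp)
  rwa [map_sub, map_smul, sub_eq_zero, smul_eq_mul] at this

end

section

variable {G X A : Type*} [Group G] [TopologicalSpace X] [CompactSpace X]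
    [MulAction G X] [ContinuousConstSMul G X] [CStarAlgebra A]

/-- A unital functional of norm at most one is positive: for `f ≥ 0`, the bound `‖‖f‖ - f‖ ≤ ‖f‖`
gives `‖f‖ - L f ≤ ‖f‖`. -/
theorem isState_re_comp (R : CovRep G X A) {φ : A →L[ℂ] ℂ} (hφ : ‖φ‖ ≤ 1) (h1 : φ 1 = 1) :
    ∃ L : C(X, ℝ) →ₗ[ℝ] ℝ, IsState L ∧ ∀ f, L f = (φ (R.π (toComplex f))).re := by
  let L : C(X, ℝ) →ₗ[ℝ] ℝ :=
    { toFun := fun f => (φ (R.π (toComplex f))).re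
      map_add' := fun f g => by
        have : toComplex (f + g) = toComplex f + toComplex g := by ext x; simp
        rw [this, map_add, map_add, Complex.add_re]
      map_smul' := fun c f => by
        have : toComplex (c • f) = (c : ℂ) • toComplex f := by ext x; simp
        rw [this, map_smul, map_smul, smul_eq_mul, Complex.re_ofReal_mul]
        rfl }
  have hone : L 1 = 1 := by
    have : toComplex (1 : C(X, ℝ)) = 1 := by ext x; simp
    change (φ (R.π (toComplex 1))).re = 1
    rw [this, map_one, h1, Complex.one_re]
  refine ⟨L, ⟨fun f hf => ?_, hone⟩, fun f => rfl⟩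
  have e : L (‖f‖ • 1 - f) = ‖f‖ - L f := by
    rw [map_sub, map_smul, hone, smul_eq_mul, mul_one]
  have h2 : L (‖f‖ • 1 - f) ≤ ‖f‖ := by
    refine (Complex.re_le_norm _).trans ((φ.le_of_opNorm_le hφ _).trans ?_)
    rw [one_mul]
    refine (NonUnitalStarAlgHom.norm_apply_le R.π _).trans ?_
    rw [ContinuousMap.norm_le _ (norm_nonneg f)]
    intro x
    have hx : f x ≤ ‖f‖ := (le_abs_self _).trans (f.norm_coe_le_norm x)
    have hx0 : 0 ≤ f x := hf x
    rw [toComplex_apply, Complex.norm_real]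
    simp only [ContinuousMap.sub_apply, ContinuousMap.smul_apply, ContinuousMap.one_apply,
      smul_eq_mul, mul_one]
    rw [Real.norm_of_nonneg (by linarith)]
    linarith
  linarith

omit [CompactSpace X] in
theorem exists_functional_of_ultrafilter [Nontrivial A] (R : CovRep G X A) {φ : A →L[ℂ] ℂ}
    (hφ : ‖φ‖ ≤ 1) (U : Ultrafilter G) : ∃ ψ : A →L[ℂ] ℂ, ‖ψ‖ ≤ 1 ∧
      ∀ T, Tendsto (fun s => φ (R.u s⁻¹ * T * R.u s)) U (𝓝 (ψ T)) := by
  let F : G → WeakDual ℂ A := fun s => StrongDual.toWeakDual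
    (φ.comp (((ContinuousLinearMap.mul ℂ A).flip (R.u s)).comp
      (ContinuousLinearMap.mul ℂ A (R.u s⁻¹))))
  have hF : ∀ s T, F s T = φ (R.u s⁻¹ * T * R.u s) := fun s T => rfl
  have hcpt := WeakDual.isCompact_closedBall (𝕜 := ℂ) (0 : StrongDual ℂ A) 1
  have hmem : ∀ s, F s ∈ WeakDual.toStrongDual ⁻¹' Metric.closedBall (0 : StrongDual ℂ A) 1 := by
    intro s
    rw [mem_preimage, mem_closedBall_zero_iff]
    refine ContinuousLinearMap.opNorm_le_bound _ zero_le_one fun T => ?_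
    change ‖φ (R.u s⁻¹ * T * R.u s)‖ ≤ _
    refine (φ.le_of_opNorm_le hφ _).trans ?_
    rw [one_mul, one_mul]
    refine (norm_mul_le _ _).trans ((mul_le_mul_of_nonneg_left (R.norm_u_le s)
      (norm_nonneg _)).trans ?_)
    rw [mul_one]
    refine (norm_mul_le _ _).trans ((mul_le_mul_of_nonneg_right (R.norm_u_le _)
      (norm_nonneg _)).trans ?_)
    rw [one_mul]
  obtain ⟨ψ, hψ, hlim⟩ := hcpt.ultrafilter_le_nhds (U.map F)
    (le_principal_iff.2 (Filter.mem_map.2 (Filter.univ_mem' hmem)))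
  refine ⟨WeakDual.toStrongDual ψ, mem_closedBall_zero_iff.1 hψ, fun T => ?_⟩
  exact ((WeakDual.eval_continuous T).tendsto ψ).comp (show Tendsto F U (𝓝 ψ) from hlim)

/-- The conjugates of `φ` restrict on `C(X)` to translates of a state, which cluster at evaluation
at `x`; Banach–Alaoglu gives a limit on all of `A`. If `g x = 1` and `g * f = 0`, then `π g` and `π
f * T` are orthogonal, so the perturbation lemma kills `ψ (π f * T)`; the other side is symmetric.
-/
theorem exists_functional_eval [T2Space X] (hX : IsGBoundary G X) (R : CovRep G X A)
    {φ : A →L[ℂ] ℂ} (hφ : ‖φ‖ ≤ 1) (h1 : φ 1 = 1) (x : X) : ∃ ψ : A →L[ℂ] ℂ, ‖ψ‖ ≤ 1 ∧ ψ 1 = 1 ∧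
      (∀ T, ψ T ∈ closure (range fun s => φ (R.u s⁻¹ * T * R.u s))) ∧
      (∀ f T, ψ (R.π f * T) = f x * ψ T) ∧ ∀ f T, ψ (T * R.π f) = f x * ψ T := by
  have : Nontrivial A := ⟨1, 0, fun h => by rw [h, map_zero] at h1; exact zero_ne_one h1⟩
  obtain ⟨L, hL, hLφ⟩ := isState_re_comp R hφ h1
  obtain ⟨l, hl, hlim⟩ := mem_closure_range_iff_exists_filter.1 (hX.mem_closure_orbit hL x)
  obtain ⟨ψ, hψ, hψlim⟩ := exists_functional_of_ultrafilter R hφ (Ultrafilter.of l)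
  have hre : ∀ f : C(X, ℝ), (ψ (R.π (toComplex f))).re = f x := by
    intro f
    have h2 := (Complex.continuous_re.tendsto _).comp (hψlim (R.π (toComplex f)))
    have h3 := (tendsto_pi_nhds.1 hlim f).mono_left (Ultrafilter.of_le l)
    refine tendsto_nhds_unique h2 (h3.congr fun s => ?_)
    rw [hLφ, Function.comp_apply, R.u_mul_π, inv_inv, mul_assoc, R.u_inv_mul_self, mul_one]
    rfl
  have hnorm : ∀ g : C(X, ℝ), 0 ≤ g → g ≤ 1 → ‖R.π (toComplex g)‖ ≤ 1 := by
    intro g hg hg1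
    refine (NonUnitalStarAlgHom.norm_apply_le R.π _).trans ?_
    rw [ContinuousMap.norm_le _ zero_le_one]
    intro y
    rw [toComplex_apply, Complex.norm_real, Real.norm_eq_abs]
    exact abs_le.2 ⟨neg_one_lt_zero.le.trans (hg y), hg1 y⟩
  have hstar : ∀ g : C(X, ℝ), star (toComplex g) = toComplex g := fun g => by ext y; simp
  refine ⟨ψ, hψ, ?_, fun T => mem_closure_of_tendsto (hψlim T)
    (Eventually.of_forall mem_range_self), fun f T => ?_, fun f T => ?_⟩
  · refine tendsto_nhds_unique (hψlim 1) (tendsto_const_nhds.congr fun s => ?_)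
    rw [mul_one, R.u_inv_mul_self, h1]
  · have := eq_eval_mul_of_local
      ((ψ : A →ₗ[ℂ] ℂ) ∘ₗ (LinearMap.mulRight ℂ T) ∘ₗ R.π.toAlgHom.toLinearMap) ‖T‖
      (fun f => by
        refine (ψ.le_of_opNorm_le hψ _).trans ?_
        rw [one_mul, mul_comm]
        exact (norm_mul_le _ _).trans (mul_le_mul_of_nonneg_right
          (NonUnitalStarAlgHom.norm_apply_le R.π _) (norm_nonneg _))) x
      (fun f g hg hg1 hgx hfg => by
        refine apply_eq_zero_of_norm_add_sq_le hψ (a := R.π (toComplex g)) ?_ fun z => ?_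
        · rw [hre, hgx]
        · refine (norm_add_sq_le_of_star_mul_eq_zero ?_).trans
            (add_le_add_left (pow_le_one₀ (norm_nonneg _) (hnorm g hg hg1)) _)
          change star (R.π (toComplex g)) * (z • (R.π f * T)) = 0
          rw [← map_star, hstar, mul_smul_comm, ← mul_assoc, ← map_mul, hfg, map_zero, zero_mul,
            smul_zero]) f
    refine this.trans ?_
    change f x * ψ (R.π 1 * T) = _
    rw [map_one, one_mul]
  · have := eq_eval_mul_of_local
      ((ψ : A →ₗ[ℂ] ℂ) ∘ₗ (LinearMap.mulLeft ℂ T) ∘ₗ R.π.toAlgHom.toLinearMap) ‖T‖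
      (fun f => by
        refine (ψ.le_of_opNorm_le hψ _).trans ?_
        rw [one_mul]
        exact (norm_mul_le _ _).trans (mul_le_mul_of_nonneg_left
          (NonUnitalStarAlgHom.norm_apply_le R.π _) (norm_nonneg _))) x
      (fun f g hg hg1 hgx hfg => by
        refine apply_eq_zero_of_norm_add_sq_le hψ (a := R.π (toComplex g)) ?_ fun z => ?_
        · rw [hre, hgx]
        · refine (norm_add_sq_le_of_mul_star_eq_zero ?_).trans
            (add_le_add_left (pow_le_one₀ (norm_nonneg _) (hnorm g hg hg1)) _)
          change R.π (toComplex g) * star (z • (T * R.π f)) = 0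
          rw [star_smul, star_mul, mul_smul_comm, ← mul_assoc, ← map_star, ← map_mul,
            ← hstar g, ← star_mul, mul_comm f, hfg, star_zero, map_zero, zero_mul, smul_zero]) f
    refine this.trans ?_
    change f x * ψ (T * R.π 1) = _
    rw [map_one, mul_one]

theorem exists_ne_eval [T2Space X] {x y : X} (h : x ≠ y) : ∃ f : C(X, ℂ), f x = 1 ∧ f y = 0 := by
  obtain ⟨f, hf0, hf1, -⟩ := exists_continuous_zero_one_of_isClosed
    (isClosed_singleton (x := y)) (isClosed_singleton (x := x)) (by simpa using h.symm)
  exact ⟨toComplex f, by simp [hf1 (mem_singleton x)], by simp [hf0 (mem_singleton y)]⟩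

theorem apply_u_eq_zero [T2Space X] (R : CovRep G X A) {ψ : A →L[ℂ] ℂ} {x : X}
    (hl : ∀ f T, ψ (R.π f * T) = f x * ψ T) (hr : ∀ f T, ψ (T * R.π f) = f x * ψ T) {s : G}
    (hs : s • x ≠ x) : ψ (R.u s) = 0 := by
  obtain ⟨f, hf1, hf0⟩ := exists_ne_eval hs
  have h := congrArg ψ (R.cov s f)
  rw [hl, hr, shift_apply, hf1, hf0, one_mul, zero_mul] at h
  exact h

theorem apply_ev_eq [T2Space X] (R : CovRep G X A) {ψ : A →L[ℂ] ℂ} {x : X} (h1 : ψ 1 = 1)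
    (hl : ∀ f T, ψ (R.π f * T) = f x * ψ T) (hr : ∀ f T, ψ (T * R.π f) = f x * ψ T)
    (c : G →₀ C(X, ℂ)) (hc : ∀ s ∈ c.support, s ≠ 1 → s • x ≠ x) : ψ (R.ev c) = c 1 x := by
  rw [CovRep.ev_apply, Finsupp.sum, map_sum, Finset.sum_eq_single 1]
  · rw [hl, map_one R.u, h1, mul_one]
  · intro s hs hs1
    rw [hl, apply_u_eq_zero R hl hr (hc s hs hs1), mul_zero]
  · intro h
    rw [Finsupp.notMem_support_iff.1 h]
    simp

end

end

noncomputable section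

/-! ### Topological freeness implies simplicity -/

theorem TwoSidedIdeal.eq_top_of_isUnit_mem {A : Type*} [Ring A] {I : TwoSidedIdeal A} {a : A}
    (ha : a ∈ I) (hu : IsUnit a) : I = ⊤ := by
  obtain ⟨b, hb⟩ := hu.exists_left_inv
  refine TwoSidedIdeal.ext fun x => ⟨fun _ => TwoSidedIdeal.mem_top A, fun _ => ?_⟩
  have := I.mul_mem_left (x * b) a ha
  rwa [mul_assoc, hb, mul_one] at this

/-- Elements at distance less than one from `1` are invertible, so `1` has norm one modulo a proper
ideal; Hahn–Banach on the quotient gives `φ`. -/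
theorem exists_functional_vanishing {A : Type*} [CStarAlgebra A] (S : StarSubalgebra ℂ A)
    (hS : IsClosed (S : Set A)) {I : TwoSidedIdeal S} (hI : I ≠ ⊤) :
    ∃ φ : A →L[ℂ] ℂ, ‖φ‖ ≤ 1 ∧ φ 1 = 1 ∧ ∀ a ∈ I, φ (a : A) = 0 := by
  let J : Submodule ℂ A :=
    { carrier := {T | ∃ a ∈ I, (a : A) = T}
      zero_mem' := ⟨0, I.zero_mem, rfl⟩
      add_mem' := by
        rintro _ _ ⟨a, ha, rfl⟩ ⟨b, hb, rfl⟩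
        exact ⟨a + b, I.add_mem ha hb, rfl⟩
      smul_mem' := by
        rintro z _ ⟨a, ha, rfl⟩
        refine ⟨algebraMap ℂ S z * a, I.mul_mem_left _ _ ha, ?_⟩
        rw [← Algebra.smul_def]
        rfl }
  have hone : ‖(Submodule.Quotient.mk 1 : A ⧸ J)‖ = 1 := by
    have : Nontrivial A := by
      by_contra h
      rw [not_nontrivial_iff_subsingleton] at h
      have : Subsingleton S := Subtype.val_injective.subsingleton
      exact hI (TwoSidedIdeal.eq_top_of_isUnit_mem I.zero_mem (isUnit_of_subsingleton 0))
    refine le_antisymm ((Submodule.Quotient.norm_mk_le J 1).trans_eq CStarRing.norm_one) ?_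
    by_contra! hlt
    obtain ⟨m, hm, hm1⟩ := Submodule.Quotient.norm_mk_lt (S := J)
      (Submodule.Quotient.mk 1 : A ⧸ J) (sub_pos.2 hlt)
    rw [add_sub_cancel] at hm1
    obtain ⟨a, ha, ham⟩ := (Submodule.Quotient.eq J).1 hm.symm
    have : CompleteSpace S := hS.completeSpace_coe
    have hnorm : ‖1 - a‖ < 1 := by
      change ‖(1 : A) - (a : A)‖ < 1
      rwa [ham, sub_sub_cancel]
    have hu : IsUnit (1 - (1 - a)) := isUnit_one_sub_of_norm_lt_one hnorm
    rw [sub_sub_cancel] at hu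
    exact hI (TwoSidedIdeal.eq_top_of_isUnit_mem ha hu)
  obtain ⟨g, hg, hg1⟩ := exists_dual_vector'' ℂ (Submodule.Quotient.mk 1 : A ⧸ J)
  have hb : ∀ T, ‖g (Submodule.Quotient.mk T)‖ ≤ 1 * ‖T‖ := fun T =>
    (g.le_of_opNorm_le hg _).trans
      (mul_le_mul_of_nonneg_left (Submodule.Quotient.norm_mk_le J T) zero_le_one)
  refine ⟨LinearMap.mkContinuous ((g : (A ⧸ J) →ₗ[ℂ] ℂ) ∘ₗ J.mkQ) 1 hb,
    LinearMap.mkContinuous_norm_le _ zero_le_one _, ?_, fun a ha => ?_⟩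
  · change g (Submodule.Quotient.mk 1) = 1
    rw [hg1, hone]
    simp
  · change g (Submodule.Quotient.mk (a : A)) = 0
    rw [(Submodule.Quotient.mk_eq_zero J).2 ⟨a, ha, rfl⟩, map_zero]

/-- Allowing a subalgebra `S` that need only contain the unitaries covers the reduced group algebra
and the crossed product together. The vectors in `Ω` detect the coefficient at `1`, and their
translates are total. -/
theorem isCStarSimple_of_isTopologicallyFree {G X K : Type*} [Group G] [TopologicalSpace X]
    [CompactSpace X] [T2Space X] [MulAction G X] [ContinuousConstSMul G X]
    [NormedAddCommGroup K] [InnerProductSpace ℂ K] [CompleteSpace K] [Nontrivial K]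
    (hX : IsGBoundary G X) (hfree : IsTopologicallyFree G X) (R : CovRep G X (K →L[ℂ] K))
    (S : StarSubalgebra ℂ (K →L[ℂ] K)) (hS : IsClosed (S : Set (K →L[ℂ] K))) (hSR : S ≤ R.cstar)
    (hu : ∀ s, R.u s ∈ S) (Ω : Set K) (hΩ : ∀ e ∈ Ω, ∀ c, ‖⟪e, R.ev c e⟫_ℂ‖ ≤ ‖c 1‖)
    (htot : ∀ T : K →L[ℂ] K, (∀ e ∈ Ω, ∀ s, T (R.u s e) = 0) → T = 0) : IsCStarSimple S := by
  refine ⟨⟨1, 0, fun h => one_ne_zero (congrArg Subtype.val h)⟩, fun I _ => ?_⟩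
  by_cases hI : I = ⊤
  · exact Or.inr hI
  left
  obtain ⟨φ, hφ, hφ1, hφI⟩ := exists_functional_vanishing S hS hI
  have hcoef : ∀ a ∈ I, ∀ (c : G →₀ C(X, ℂ)) (ε : ℝ), 0 < ε → ‖(a : K →L[ℂ] K) - R.ev c‖ < ε →
      ‖c 1‖ ≤ ε := by
    intro a ha c ε hε hac
    rw [ContinuousMap.norm_le _ hε.le]
    have hopen : ∀ s : G, IsOpen {x : X | s • x ≠ x} := fun s =>
      isOpen_ne_fun (continuous_const_smul s) continuous_id
    -- Finitely many open dense sets: at a point of the intersection `ψ` sees only the coefficient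
    -- at `1`.
    have hD : Dense (⋂ s ∈ {s : G | s ∈ c.support ∧ s ≠ 1}, {x : X | s • x ≠ x}) :=
      dense_biInter_of_isOpen (fun s _ => hopen s)
        ((c.support.finite_toSet.subset fun s hs => hs.1).countable) fun s hs => hfree s hs.2
    have hcl : IsClosed {x : X | ‖c 1 x‖ ≤ ε} := isClosed_le (by fun_prop) continuous_const
    intro x
    refine hcl.closure_subset_iff.2 (fun y hy => ?_) (hD x)
    obtain ⟨ψ, hψ, hψ1, hψcl, hl, hr⟩ := exists_functional_eval hX R hφ hφ1 y
    have hψa : ψ a = 0 := by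
      have h0 : ∀ s, φ (R.u s⁻¹ * a * R.u s) = 0 := fun s =>
        hφI (⟨R.u s⁻¹, hu _⟩ * a * ⟨R.u s, hu s⟩)
          (I.mul_mem_right _ _ (I.mul_mem_left _ _ ha))
      have := hψcl a
      simp only [h0] at this
      have h2 : ψ a ∈ closure {(0 : ℂ)} := closure_mono (by rintro _ ⟨s, rfl⟩; rfl) this
      simpa using h2
    have hev := apply_ev_eq R hψ1 hl hr c fun s hs hs1 => by
      have := mem_iInter₂.1 hy s ⟨hs, hs1⟩
      exact this
    change ‖c 1 y‖ ≤ ε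
    have e1 : c 1 y = -ψ (a - R.ev c) := by rw [map_sub, hψa, hev, zero_sub, neg_neg]
    rw [e1, norm_neg]
    exact ((ψ.le_of_opNorm_le hψ _).trans_eq (one_mul _)).trans hac.le
  have hinner : ∀ a ∈ I, ∀ e ∈ Ω, ⟪e, (a : K →L[ℂ] K) e⟫_ℂ = 0 := by
    intro a ha e he
    by_contra hne
    have hpos : 0 < ‖⟪e, (a : K →L[ℂ] K) e⟫_ℂ‖ := norm_pos_iff.2 hne
    set ε := ‖⟪e, (a : K →L[ℂ] K) e⟫_ℂ‖ / (2 * (‖e‖ ^ 2 + 1)) with hεdef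
    have hε : 0 < ε := by positivity
    obtain ⟨_, ⟨c, rfl⟩, hc⟩ := Metric.mem_closure_iff.1 (R.mem_cstar.1 (hSR a.2)) ε hε
    rw [dist_eq_norm] at hc
    have h1 := hcoef a ha c ε hε hc
    have h2 : ⟪e, (a : K →L[ℂ] K) e⟫_ℂ =
        ⟪e, ((a : K →L[ℂ] K) - R.ev c) e⟫_ℂ + ⟪e, R.ev c e⟫_ℂ := by
      rw [← inner_add_right, ← add_apply, sub_add_cancel]
    have h3 : ‖⟪e, ((a : K →L[ℂ] K) - R.ev c) e⟫_ℂ‖ ≤ ε * ‖e‖ ^ 2 := by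
      refine (norm_inner_le_norm _ _).trans ?_
      have := ContinuousLinearMap.le_of_opNorm_le _ hc.le e
      nlinarith [norm_nonneg e]
    have h4 : ‖⟪e, (a : K →L[ℂ] K) e⟫_ℂ‖ ≤ ε * ‖e‖ ^ 2 + ε := by
      rw [h2]
      exact (norm_add_le _ _).trans (add_le_add h3 ((hΩ e he c).trans h1))
    have h5 : ε * ‖e‖ ^ 2 + ε = ‖⟪e, (a : K →L[ℂ] K) e⟫_ℂ‖ / 2 := by
      rw [hεdef]
      field_simp
    linarith
  have hvec : ∀ a ∈ I, ∀ e ∈ Ω, (a : K →L[ℂ] K) e = 0 := by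
    intro a ha e he
    have h := hinner (star a * a) (I.mul_mem_left _ _ ha) e he
    change ⟪e, (star (a : K →L[ℂ] K)) ((a : K →L[ℂ] K) e)⟫_ℂ = 0 at h
    rw [ContinuousLinearMap.star_eq_adjoint, ContinuousLinearMap.adjoint_inner_right] at h
    exact inner_self_eq_zero.1 h
  refine TwoSidedIdeal.ext fun a => ⟨fun ha => ?_, fun ha => ?_⟩
  · rw [TwoSidedIdeal.mem_bot]
    refine Subtype.ext (htot _ fun e he s => ?_)
    exact hvec (a * (⟨R.u s, hu s⟩ : S)) (I.mul_mem_right _ _ ha) e he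
  · rw [TwoSidedIdeal.mem_bot] at ha
    exact ha ▸ I.zero_mem

end

noncomputable section

/-! ### Approximately equivariant unit vectors from equivariant means -/

theorem memℓp_one_translate {G : Type*} [Group G] (s : G) (p : lp (fun _ : G => ℝ) 1) :
    Memℓp (fun t => p (s⁻¹ * t)) 1 := by
  refine memℓp_gen ?_
  exact ((Equiv.mulLeft s⁻¹).summable_iff (f := fun i => ‖p i‖ ^ (1 : ℝ≥0∞).toReal)).2
    ((lp.memℓp p).summable (by norm_num))

/-- Left translation on `ℓ¹(G)`. -/
def translateOne {G : Type*} [Group G] (s : G) :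
    lp (fun _ : G => ℝ) 1 →ₗ[ℝ] lp (fun _ : G => ℝ) 1 where
  toFun p := ⟨fun t => p (s⁻¹ * t), memℓp_one_translate s p⟩
  map_add' _ _ := rfl
  map_smul' _ _ := rfl

@[simp]
theorem translateOne_apply {G : Type*} [Group G] (s : G) (p : lp (fun _ : G => ℝ) 1) (t : G) :
    translateOne s p t = p (s⁻¹ * t) := rfl

theorem translateOne_single {G : Type*} [Group G] [DecidableEq G] (s g : G) (r : ℝ) :
    translateOne s (lp.single 1 g r) = lp.single 1 (s * g) r := by
  ext t
  simp only [translateOne_apply, lp.single_apply, Pi.single_apply, inv_mul_eq_iff_eq_mul]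

section Means

variable {G : Type*} [Group G] [TopologicalSpace G] [DiscreteTopology G] {X : Type*}
  {m : X → (G →ᵇ ℝ) → ℝ}

omit [Group G] [DiscreteTopology G] in
theorem IsMean.map_sum {m : (G →ᵇ ℝ) → ℝ} (hm : IsMean m) {J : Type*} (S : Finset J)
    (a : J → G →ᵇ ℝ) : m (∑ j ∈ S, a j) = ∑ j ∈ S, m (a j) :=
  _root_.map_sum (hm.linear.mk' m) a S

omit [Group G] [DiscreteTopology G] in
-- Integration over independent variables `g z`, one for each point `z`: collect the terms belonging
-- to `z` and choose `g z` almost below their mean.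
theorem le_sum_of_forall_le_sum (hm : ∀ x, IsMean (m x)) {J : Type*} [Fintype J] (a : J → G →ᵇ ℝ)
    (x : J → X) {u : ℝ} (h : ∀ g : X → G, u ≤ ∑ j, a j (g (x j))) : u ≤ ∑ j, m (x j) (a j) := by
  classical
  by_contra! hlt
  set Y : Finset X := Finset.univ.image x
  have hY : ∀ j ∈ (Finset.univ : Finset J), x j ∈ Y := fun j hj => Finset.mem_image_of_mem x hj
  set η : ℝ := (u - ∑ j, m (x j) (a j)) / (Y.card + 1)
  have hη : 0 < η := div_pos (sub_pos.2 hlt) (by positivity)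
  let b : X → G →ᵇ ℝ := fun z => ∑ j with x j = z, a j
  have hex : ∀ z, ∃ g, b z g < m z (b z) + η := by
    intro z
    by_contra! hge
    have := (hm z).le_apply hge
    linarith
  choose g hg using hex
  have e1 : ∑ j, a j (g (x j)) = ∑ z ∈ Y, b z (g z) := by
    rw [← Finset.sum_fiberwise_of_maps_to hY]
    refine Finset.sum_congr rfl fun z _ => ?_
    rw [BoundedContinuousFunction.sum_apply]
    exact Finset.sum_congr rfl fun j hj => by rw [(Finset.mem_filter.1 hj).2]
  have e2 : ∑ j, m (x j) (a j) = ∑ z ∈ Y, m z (b z) := by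
    rw [← Finset.sum_fiberwise_of_maps_to hY]
    refine Finset.sum_congr rfl fun z _ => ?_
    rw [(hm z).map_sum]
    exact Finset.sum_congr rfl fun j hj => by rw [(Finset.mem_filter.1 hj).2]
  have h1 : u ≤ ∑ z ∈ Y, (m z (b z) + η) := (h g).trans
    (e1.le.trans (Finset.sum_le_sum fun z _ => (hg z).le))
  rw [Finset.sum_add_distrib, ← e2, Finset.sum_const, nsmul_eq_mul] at h1
  have h2 : (Y.card + 1) * η = u - ∑ j, m (x j) (a j) := by
    simp only [η]
    field_simp
  linarith

variable [MulAction G X]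

/-- Day's convexity argument. Otherwise Hahn–Banach separates the equivariance defects from zero by
some `u > 0`. Tested on point masses, the separating functional becomes bounded functions `H j`;
averaging with the means gives `u ≤ 0` by equivariance. -/
theorem exists_approx_equivariant_one (hm : ∀ x, IsMean (m x))
    (hequiv : ∀ (s : G) x a, m (s • x) a = m x (bshift s a)) (F : Finset (G × X)) {ε : ℝ}
    (hε : 0 < ε) : ∃ p : X → lp (fun _ : G => ℝ) 1, (∀ x t, 0 ≤ p x t) ∧ (∀ x, HasSum (p x) 1) ∧
      ∀ j ∈ F, ‖translateOne j.1 (p j.2) - p (j.1 • j.2)‖ < ε := by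
  classical
  let P : Set (X → lp (fun _ : G => ℝ) 1) := {p | (∀ x t, 0 ≤ p x t) ∧ ∀ x, HasSum (p x) 1}
  let D : (X → lp (fun _ : G => ℝ) 1) →ₗ[ℝ] (F → lp (fun _ : G => ℝ) 1) :=
    { toFun := fun p j => translateOne j.1.1 (p j.1.2) - p (j.1.1 • j.1.2)
      map_add' := fun p q => by
        funext j
        simp only [Pi.add_apply, map_add]
        abel
      map_smul' := fun c p => by
        funext j
        simp only [Pi.smul_apply, map_smul, smul_sub, RingHom.id_apply] }
  have hP : Convex ℝ P := by
    intro p hp q hq a b ha hb hab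
    refine ⟨fun x t => ?_, fun x => ?_⟩
    · exact add_nonneg (mul_nonneg ha (hp.1 x t)) (mul_nonneg hb (hq.1 x t))
    · have := ((hp.2 x).mul_left a).add ((hq.2 x).mul_left b)
      rw [mul_one, mul_one, hab] at this
      exact this
  by_contra! hno
  have hdisj : Disjoint (Metric.ball (0 : F → lp (fun _ : G => ℝ) 1) ε) (Set.image D P) := by
    rw [Set.disjoint_left]
    rintro _ hball ⟨p, hp, rfl⟩
    obtain ⟨j, hj, hle⟩ := hno p hp.1 hp.2
    rw [mem_ball_zero_iff] at hball
    exact absurd ((norm_le_pi_norm (D p) ⟨j, hj⟩).trans_lt hball) (not_lt.2 hle)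
  obtain ⟨f, u, hf1, hf2⟩ := geometric_hahn_banach_open (convex_ball _ _) Metric.isOpen_ball
    (hP.linear_image D) hdisj
  have hu : 0 < u := by
    have := hf1 0 (Metric.mem_ball_self hε)
    rwa [map_zero] at this
  let H : F → G →ᵇ ℝ := fun j => BoundedContinuousFunction.ofNormedAddCommGroup
    (fun g => f (Pi.single j (lp.single 1 g 1))) continuous_of_discreteTopology ‖f‖ fun g => by
      refine (f.le_opNorm _).trans ?_
      have : ‖(Pi.single j (lp.single 1 g 1) : F → lp (fun _ : G => ℝ) 1)‖ ≤ 1 := by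
        rw [Pi.norm_single, lp.norm_single (by norm_num), norm_one]
      exact mul_le_of_le_one_right (norm_nonneg _) this
  have hH : ∀ j g, H j g = f (Pi.single j (lp.single 1 g 1)) := fun j g => rfl
  have key := le_sum_of_forall_le_sum hm (J := F ⊕ F)
    (Sum.elim (fun j => bshift j.1.1 (H j)) fun j => -H j)
    (Sum.elim (fun j => j.1.2) fun j => j.1.1 • j.1.2) (u := u) (fun g => by
      refine (hf2 _ ⟨fun x => lp.single 1 (g x) 1, ⟨fun x t => ?_, fun x => ?_⟩, rfl⟩).trans_eq ?_
      · change 0 ≤ (Pi.single (g x) 1 : G → ℝ) t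
        rw [Pi.single_apply]
        split_ifs <;> norm_num
      · exact hasSum_pi_single (g x) (1 : ℝ)
      · rw [← Finset.univ_sum_single (D _), map_sum, Fintype.sum_sum_type, ← Finset.sum_add_distrib]
        refine Finset.sum_congr rfl fun j _ => ?_
        simp only [Sum.elim_inl, Sum.elim_inr, bshift_apply, BoundedContinuousFunction.neg_apply,
          hH]
        rw [← sub_eq_add_neg, ← map_sub, ← Pi.single_sub, ← translateOne_single]
        rfl)
  rw [Fintype.sum_sum_type, ← Finset.sum_add_distrib, Finset.sum_eq_zero] at key
  · exact absurd key (not_le.2 hu)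
  · intro j _
    simp only [Sum.elim_inl, Sum.elim_inr]
    rw [(hm _).linear.map_neg, hequiv, add_neg_cancel]

end Means

theorem sq_sqrt_sub_sqrt_le {a b : ℝ} (ha : 0 ≤ a) (hb : 0 ≤ b) : (√a - √b) ^ 2 ≤ |a - b| := by
  have h1 := Real.sq_sqrt ha
  have h2 := Real.sq_sqrt hb
  have h3 := Real.sqrt_nonneg a
  have h4 := Real.sqrt_nonneg b
  rcases le_total b a with h | h
  · have := Real.sqrt_le_sqrt h
    rw [abs_of_nonneg (sub_nonneg.2 h)]
    nlinarith
  · have := Real.sqrt_le_sqrt h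
    rw [abs_of_nonpos (sub_nonpos.2 h)]
    nlinarith

theorem EllTwo.norm_sq_eq_tsum {ι : Type*} (v : EllTwo ι) : ‖v‖ ^ 2 = ∑' i, ‖v i‖ ^ 2 := by
  have := lp.norm_rpow_eq_tsum (p := 2) (by norm_num) v
  simpa using this

theorem EllTwo.summable_norm_sq {ι : Type*} (v : EllTwo ι) : Summable fun i => ‖v i‖ ^ 2 := by
  have := (lp.memℓp v).summable (p := 2) (by norm_num)
  simpa using this

theorem EllTwo.enorm_sq_eq_tsum {ι : Type*} (v : EllTwo ι) : ‖v‖ₑ ^ 2 = ∑' i, ‖v i‖ₑ ^ 2 := by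
  have e : ∀ r : ℝ, 0 ≤ r → ENNReal.ofReal (r ^ 2) = ENNReal.ofReal r ^ 2 := fun r hr =>
    ENNReal.ofReal_pow hr 2
  rw [← ofReal_norm, ← e _ (norm_nonneg _), norm_sq_eq_tsum,
    ENNReal.ofReal_tsum_of_nonneg (fun i => by positivity) (summable_norm_sq v)]
  exact tsum_congr fun i => by rw [e _ (norm_nonneg _), ofReal_norm]

theorem memℓp_two_of_tsum_ne_top {ι : Type*} {v : ι → ℂ} (h : ∑' i, ‖v i‖ₑ ^ 2 ≠ ⊤) :
    Memℓp v 2 := by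
  refine memℓp_gen ?_
  have := ENNReal.summable_toReal h
  simpa using this

/-- Take square roots of the `ℓ¹` densities; `(√a - √b) ^ 2 ≤ |a - b|` explains the tolerance `ε ^
2`. -/
theorem exists_approx_equivariant_two {G X : Type*} [Group G] [TopologicalSpace G]
    [DiscreteTopology G] [MulAction G X] {m : X → (G →ᵇ ℝ) → ℝ} (hm : ∀ x, IsMean (m x))
    (hequiv : ∀ (s : G) x a, m (s • x) a = m x (bshift s a)) (F : Finset (G × X)) {ε : ℝ}
    (hε : 0 < ε) : ∃ ξ : X → EllTwo G, (∀ x, ‖ξ x‖ = 1) ∧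
      ∀ j ∈ F, ‖leftRegular G j.1 (ξ j.2) - ξ (j.1 • j.2)‖ < ε := by
  obtain ⟨p, hp0, hp1, hp⟩ := exists_approx_equivariant_one hm hequiv F (pow_pos hε 2)
  have hsq : ∀ x t, ‖((√(p x t) : ℝ) : ℂ)‖ ^ 2 = p x t := fun x t => by
    rw [Complex.norm_real, Real.norm_of_nonneg (Real.sqrt_nonneg _), Real.sq_sqrt (hp0 x t)]
  have hmem : ∀ x, Memℓp (fun t => ((√(p x t) : ℝ) : ℂ)) 2 := fun x => by
    refine memℓp_gen ?_
    have := (hp1 x).summable.congr fun t => (hsq x t).symm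
    simpa using this
  let ξ : X → EllTwo G := fun x => ⟨fun t => ((√(p x t) : ℝ) : ℂ), hmem x⟩
  have hξ : ∀ x t, ξ x t = ((√(p x t) : ℝ) : ℂ) := fun x t => rfl
  refine ⟨ξ, fun x => ?_, fun j hj => ?_⟩
  · have : ‖ξ x‖ ^ 2 = 1 := by
      rw [EllTwo.norm_sq_eq_tsum]
      simp only [hξ, hsq]
      exact (hp1 x).tsum_eq
    exact (pow_eq_one_iff_of_nonneg (norm_nonneg _) two_ne_zero).1 this
  · refine lt_of_pow_lt_pow_left₀ 2 hε.le (lt_of_le_of_lt ?_ (hp j hj))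
    have e1 := lp.norm_rpow_eq_tsum (p := 1) (by norm_num)
      (translateOne j.1 (p j.2) - p (j.1 • j.2))
    have hs := (lp.memℓp (translateOne j.1 (p j.2) - p (j.1 • j.2))).summable (p := 1) (by norm_num)
    simp only [ENNReal.toReal_one, Real.rpow_one] at e1 hs
    rw [EllTwo.norm_sq_eq_tsum, e1]
    refine (EllTwo.summable_norm_sq _).tsum_le_tsum (fun t => ?_) hs
    change ‖((√(p j.2 (j.1⁻¹ * t)) : ℝ) : ℂ) - ((√(p (j.1 • j.2) t) : ℝ) : ℂ)‖ ^ 2 ≤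
      |p j.2 (j.1⁻¹ * t) - p (j.1 • j.2) t|
    rw [← Complex.ofReal_sub, Complex.norm_real, Real.norm_eq_abs, sq_abs]
    exact sq_sqrt_sub_sqrt_le (hp0 _ _) (hp0 _ _)

/-! ### The permutation representation is weakly contained in the regular ones -/

/-- The action of `G` on itself by left translations. -/
def leftPerm (G : Type*) [Group G] : G →* Equiv.Perm G where
  toFun := Equiv.mulLeft
  map_one' := by
    ext
    simp
  map_mul' s t := by
    ext
    simp

section

variable {G B X : Type*} [Group G] [TopologicalSpace B] [CompactSpace B] [MulAction G B]
    [ContinuousConstSMul G B]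

/-- The regular covariant representation on `ℓ²(G)` given by the orbit of `b`. -/
def regRep (b : B) : CovRep G B (EllTwo G →L[ℂ] EllTwo G) :=
  permRep (leftPerm G) (fun t => t • b) fun s t => mul_smul s t b

/-- The covariant representation on `ℓ²(X)` given by an equivariant map `q`. -/
def orbitRep [MulAction G X] (q : X → B) (hq : ∀ (s : G) x, q (s • x) = s • q x) :
    CovRep G B (EllTwo X →L[ℂ] EllTwo X) :=
  permRep (MulAction.toPermHom G X) q hq

theorem regRep_ev_apply (b : B) (c : G →₀ C(B, ℂ)) (ξ : EllTwo G) (t : G) :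
    (regRep b).ev c ξ t = ∑ s ∈ c.support, c s (t • b) * ξ (s⁻¹ * t) :=
  permRep_ev_apply _ _ _ c ξ t

theorem orbitRep_ev_apply [MulAction G X] (q : X → B) (hq : ∀ (s : G) x, q (s • x) = s • q x)
    (c : G →₀ C(B, ℂ)) (ξ : EllTwo X) (x : X) :
    (orbitRep q hq).ev c ξ x = ∑ s ∈ c.support, c s (q x) * ξ (s⁻¹ • x) :=
  permRep_ev_apply _ _ _ c ξ x

theorem tsum_tsum_smul [MulAction G X] (h : X → G → ℝ≥0∞) :
    ∑' z, ∑' t : G, h (t • z) t = ∑' y, ∑' t, h y t := by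
  rw [ENNReal.tsum_comm, ENNReal.tsum_comm (f := h)]
  exact tsum_congr fun t => (MulAction.toPerm t).tsum_eq fun y => h y t

/-- Fell absorption: tensor `ζ` with the almost equivariant vectors, `ζ y * ξ y t`. Under `(z, t) ↦
(t • z, t)` this splits into vectors `v z` acted on by the regular representations at `q z`, while
near equivariance makes the result `w y` close to `T ζ y • ξ y`. -/
theorem norm_orbitRep_ev_le [TopologicalSpace G] [DiscreteTopology G] [MulAction G X]
    {m : X → (G →ᵇ ℝ) → ℝ} (hm : ∀ x, IsMean (m x))
    (hequiv : ∀ (s : G) x a, m (s • x) a = m x (bshift s a))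
    (q : X → B) (hq : ∀ (s : G) x, q (s • x) = s • q x) (c : G →₀ C(B, ℂ)) {C : ℝ} (hC0 : 0 ≤ C)
    (hC : ∀ z, ‖(regRep (q z)).ev c‖ ≤ C) : ‖(orbitRep q hq).ev c‖ ≤ C := by
  classical
  refine ContinuousLinearMap.opNorm_le_bound _ hC0 fun ζ => ?_
  set T := (orbitRep q hq).ev c with hT
  refine lp.norm_le_of_forall_sum_le (by norm_num) (by positivity) fun Y => ?_
  simp only [ENNReal.toReal_ofNat, Real.rpow_ofNat]
  set M : ℝ := ∑ s ∈ c.support, ‖c s‖ * ‖ζ‖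
  -- Finitely many coordinates `Y` keep the equivariance conditions finite; the `max` guards against
  -- a negative lower bound for `‖w y‖`.
  have main : ∀ ε > 0, ∑ y ∈ Y, (max 0 (‖T ζ y‖ - ε * M)) ^ 2 ≤ (C * ‖ζ‖) ^ 2 := by
    intro ε hε
    obtain ⟨ξ, hξ1, hξ⟩ := exists_approx_equivariant_two hm hequiv
      ((c.support ×ˢ Y).image fun j => (j.1, j.1⁻¹ • j.2)) hε
    have hξe : ∀ y, ∑' t, ‖ξ y t‖ₑ ^ 2 = 1 := fun y => by
      rw [← EllTwo.enorm_sq_eq_tsum, ← ofReal_norm, hξ1]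
      simp
    have htot : ∑' z, ∑' t : G, ‖ζ (t • z) * ξ (t • z) t‖ₑ ^ 2 = ‖ζ‖ₑ ^ 2 := by
      rw [tsum_tsum_smul fun y t => ‖ζ y * ξ y t‖ₑ ^ 2, EllTwo.enorm_sq_eq_tsum ζ]
      refine tsum_congr fun y => ?_
      simp only [enorm_mul, mul_pow]
      rw [ENNReal.tsum_mul_left, hξe, mul_one]
    have hfin : ∀ z, ∑' t : G, ‖ζ (t • z) * ξ (t • z) t‖ₑ ^ 2 ≠ ⊤ := fun z => by
      refine ne_top_of_le_ne_top ?_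
        (ENNReal.le_tsum (f := fun z => ∑' t : G, ‖ζ (t • z) * ξ (t • z) t‖ₑ ^ 2) z)
      rw [htot]
      simp
    let v : X → EllTwo G := fun z => ⟨fun t => ζ (t • z) * ξ (t • z) t,
      memℓp_two_of_tsum_ne_top (hfin z)⟩
    let w : X → EllTwo G := fun y => ∑ s ∈ c.support,
      (c s (q y) * ζ (s⁻¹ • y)) • leftRegular G s (ξ (s⁻¹ • y))
    have hw : ∀ y t, w y t = ∑ s ∈ c.support, c s (q y) * ζ (s⁻¹ • y) * ξ (s⁻¹ • y) (s⁻¹ * t) :=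
      fun y t => by
        simp only [w]
        rw [lp.coeFn_sum, Finset.sum_apply]
        rfl
    have hvw : ∀ z t, (regRep (q z)).ev c (v z) t = w (t • z) t := fun z t => by
      rw [regRep_ev_apply, hw]
      refine Finset.sum_congr rfl fun s _ => ?_
      change c s (t • q z) * (ζ ((s⁻¹ * t) • z) * ξ ((s⁻¹ * t) • z) (s⁻¹ * t)) = _
      rw [mul_smul, hq, mul_assoc]
    have hsum : ∑' y, ‖w y‖ₑ ^ 2 ≤ ENNReal.ofReal C ^ 2 * ‖ζ‖ₑ ^ 2 := by
      calc ∑' y, ‖w y‖ₑ ^ 2 = ∑' y, ∑' t, ‖w y t‖ₑ ^ 2 :=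
            tsum_congr fun y => EllTwo.enorm_sq_eq_tsum _
        _ = ∑' z, ∑' t : G, ‖w (t • z) t‖ₑ ^ 2 := (tsum_tsum_smul fun y t => ‖w y t‖ₑ ^ 2).symm
        _ = ∑' z, ‖(regRep (q z)).ev c (v z)‖ₑ ^ 2 := tsum_congr fun z => by
            rw [EllTwo.enorm_sq_eq_tsum]
            simp only [hvw]
        _ ≤ ∑' z, ENNReal.ofReal C ^ 2 * ‖v z‖ₑ ^ 2 := ENNReal.tsum_le_tsum fun z => by
            rw [← mul_pow]
            refine pow_le_pow_left' ?_ 2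
            rw [← ofReal_norm, ← ofReal_norm, ← ENNReal.ofReal_mul hC0]
            exact ENNReal.ofReal_le_ofReal (ContinuousLinearMap.le_of_opNorm_le _ (hC z) _)
        _ = ENNReal.ofReal C ^ 2 * ‖ζ‖ₑ ^ 2 := by
            rw [ENNReal.tsum_mul_left, ← htot]
            simp only [EllTwo.enorm_sq_eq_tsum, v]
    have hsumY : ∑ y ∈ Y, ‖w y‖ ^ 2 ≤ (C * ‖ζ‖) ^ 2 := by
      have h1 := (ENNReal.sum_le_tsum Y).trans hsum
      have e1 : ∑ y ∈ Y, ‖w y‖ₑ ^ 2 = ENNReal.ofReal (∑ y ∈ Y, ‖w y‖ ^ 2) := by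
        rw [ENNReal.ofReal_sum_of_nonneg fun y _ => by positivity]
        refine Finset.sum_congr rfl fun y _ => ?_
        rw [ENNReal.ofReal_pow (norm_nonneg _), ofReal_norm]
      rw [e1, ← mul_pow, ← ofReal_norm, ← ENNReal.ofReal_mul hC0,
        ← ENNReal.ofReal_pow (by positivity), ENNReal.ofReal_le_ofReal_iff (by positivity)] at h1
      exact h1
    refine (Finset.sum_le_sum fun y hy => ?_).trans hsumY
    refine pow_le_pow_left₀ (le_max_left _ _) (max_le (norm_nonneg _) ?_) 2
    have e2 : T ζ y • ξ y - w y = ∑ s ∈ c.support,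
        (c s (q y) * ζ (s⁻¹ • y)) • (ξ y - leftRegular G s (ξ (s⁻¹ • y))) := by
      simp only [w, smul_sub]
      rw [Finset.sum_sub_distrib, ← Finset.sum_smul, hT, orbitRep_ev_apply]
    have h2 : ‖T ζ y • ξ y - w y‖ ≤ ε * M := by
      rw [e2, Finset.mul_sum]
      refine norm_sum_le_of_le _ fun s hs => ?_
      rw [norm_smul, norm_mul, mul_comm ε]
      have h3 := hξ (s, s⁻¹ • y) (Finset.mem_image.2 ⟨(s, y), Finset.mk_mem_product hs hy, rfl⟩)
      simp only [smul_inv_smul] at h3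
      rw [norm_sub_rev]
      exact mul_le_mul (mul_le_mul ((c s).norm_coe_le_norm _)
        (lp.norm_apply_le_norm (by norm_num) _ _) (norm_nonneg _) (norm_nonneg _)) h3.le (norm_nonneg _) (by positivity)
    have h4 : ‖T ζ y‖ = ‖T ζ y • ξ y‖ := by rw [norm_smul, hξ1, mul_one]
    have h5 := norm_sub_norm_le (T ζ y • ξ y) (w y)
    linarith
  have hlim : Tendsto (fun ε : ℝ => ∑ y ∈ Y, (max 0 (‖T ζ y‖ - ε * M)) ^ 2) (𝓝[>] 0)
      (𝓝 (∑ y ∈ Y, ‖T ζ y‖ ^ 2)) := by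
    have hc : Continuous fun ε : ℝ => ∑ y ∈ Y, (max 0 (‖T ζ y‖ - ε * M)) ^ 2 := by fun_prop
    have := hc.tendsto 0
    simp only [zero_mul, sub_zero, max_eq_right (norm_nonneg _)] at this
    exact this.mono_left nhdsWithin_le_nhds
  exact le_of_tendsto hlim (eventually_nhdsWithin_of_forall fun ε hε => main ε hε)

end

end

noncomputable section

/-! ### Simplicity implies topological freeness -/

/-- The domination yields a homomorphism `R.ev c ↦ R'.ev c` of C*-algebras, realised by its graph
`D`. Simplicity makes it injective, hence isometric. -/
theorem norm_ev_le_of_isCStarSimple {G B A A' : Type*} [Group G] [TopologicalSpace B]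
    [MulAction G B] [ContinuousConstSMul G B] [CStarAlgebra A] [CStarAlgebra A'] [Nontrivial A']
    (R : CovRep G B A) (R' : CovRep G B A') (hle : ∀ c, ‖R'.ev c‖ ≤ ‖R.ev c‖)
    (hs : IsCStarSimple R.cstar) (c : G →₀ C(B, ℂ)) : ‖R.ev c‖ ≤ ‖R'.ev c‖ := by
  set D := (R.prod R').cstar with hD
  have hDc : IsClosed (D : Set (A × A')) := (R.prod R').isClosed_cstar
  have hcl : IsClosed {d : A × A' | ‖d.2‖ ≤ ‖d.1‖} :=
    isClosed_le continuous_snd.norm continuous_fst.norm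
  have hnorm : ∀ d ∈ D, ‖d.2‖ ≤ ‖d.1‖ := by
    intro d hd
    refine hcl.closure_subset_iff.2 ?_ hd
    rintro _ ⟨c, rfl⟩
    rw [CovRep.prod_ev]
    exact hle c
  have hfst : ∀ d ∈ D, d.1 ∈ R.cstar := by
    intro d hd
    refine map_mem_closure continuous_fst hd ?_
    rintro _ ⟨c, rfl⟩
    rw [CovRep.prod_ev]
    exact ⟨c, rfl⟩
  have hsurj : ∀ a ∈ R.cstar, ∃ a', (a, a') ∈ D := by
    have hcomp : CompleteSpace D := hDc.completeSpace_coe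
    let f : D →+ A := (AddMonoidHom.fst A A').comp (AddSubmonoidClass.subtype D)
    -- By domination the maximum norm of a pair in `D` is that of its first entry, so the first
    -- projection has closed range.
    have hf : Isometry f := AddMonoidHomClass.isometry_of_norm f fun d =>
      (max_eq_left (hnorm d.1 d.2)).symm
    intro a ha
    have hr : a ∈ range f := by
      refine hf.isClosedEmbedding.isClosed_range.closure_subset_iff.2 ?_ ha
      rintro _ ⟨c, rfl⟩
      refine ⟨⟨(R.prod R').ev c, (R.prod R').ev_mem_cstar c⟩, ?_⟩
      change ((R.prod R').ev c).1 = R.ev c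
      rw [CovRep.prod_ev]
    obtain ⟨d, hd⟩ := hr
    refine ⟨d.1.2, ?_⟩
    rw [← hd]
    exact d.2
  let I : TwoSidedIdeal R.cstar := TwoSidedIdeal.mk' {a | ((a : A), (0 : A')) ∈ D}
    (D.zero_mem) (fun {x y} hx hy => by simpa using D.add_mem hx hy)
    (fun {x} hx => by simpa using D.neg_mem hx)
    (fun {x y} hy => by
      obtain ⟨x', hx'⟩ := hsurj x x.2
      simpa using D.mul_mem hx' hy)
    (fun {x y} hx => by
      obtain ⟨y', hy'⟩ := hsurj y y.2
      simpa using D.mul_mem hx hy')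
  have hmem : ∀ a : R.cstar, a ∈ I ↔ ((a : A), (0 : A')) ∈ D := fun a =>
    TwoSidedIdeal.mem_mk' _ _ _ _ _ _ a
  have hIc : IsClosed (I : Set R.cstar) := by
    have : (I : Set R.cstar) = (fun a : R.cstar => ((a : A), (0 : A'))) ⁻¹' D := by
      ext a
      exact hmem a
    rw [this]
    exact hDc.preimage (by fun_prop)
  have hbot : I = ⊥ := by
    refine (hs.2 I hIc).resolve_right fun htop => ?_
    have h1 : ((1 : A), (0 : A')) ∈ D := (hmem 1).1 (htop ▸ TwoSidedIdeal.mem_top _)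
    have h2 := hnorm _ (D.sub_mem D.one_mem h1)
    simp only [Prod.snd_sub, Prod.fst_sub, Prod.fst_one, Prod.snd_one, sub_self, sub_zero,
      norm_zero, CStarRing.norm_one] at h2
    exact not_le.2 zero_lt_one h2
  have hinj : ∀ d ∈ D, d.2 = 0 → d = 0 := by
    intro d hd h0
    have h1 : (⟨d.1, hfst d hd⟩ : R.cstar) ∈ I := by
      rw [hmem, ← h0]
      exact hd
    rw [hbot, TwoSidedIdeal.mem_bot] at h1
    exact Prod.ext (congrArg Subtype.val h1) h0
  have : IsClosed (D : Set (A × A')) := hDc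
  let g : D →⋆ₐ[ℂ] A' := (StarAlgHom.snd ℂ A A').comp D.subtype
  have hg : Function.Injective g := by
    rw [injective_iff_map_eq_zero]
    exact fun d hd => Subtype.ext (hinj d.1 d.2 hd)
  have h := NonUnitalStarAlgHom.norm_map g hg ⟨(R.prod R').ev c, (R.prod R').ev_mem_cstar c⟩
  have e1 : g ⟨(R.prod R').ev c, (R.prod R').ev_mem_cstar c⟩ = R'.ev c := by
    change ((R.prod R').ev c).2 = _
    rw [CovRep.prod_ev]
  have e2 : ‖(⟨(R.prod R').ev c, (R.prod R').ev_mem_cstar c⟩ : D)‖ = ‖(R.ev c, R'.ev c)‖ := by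
    rw [← CovRep.prod_ev]
    rfl
  rw [e1, e2] at h
  rw [h]
  exact norm_fst_le (R.ev c, R'.ev c)

theorem exists_functional_of_norm_le {V E : Type*} [AddCommGroup V] [Module ℂ V]
    [NormedAddCommGroup E] [NormedSpace ℂ E] (T : V →ₗ[ℂ] E) (l : V →ₗ[ℂ] ℂ)
    (h : ∀ v, ‖l v‖ ≤ ‖T v‖) : ∃ φ : E →L[ℂ] ℂ, ‖φ‖ ≤ 1 ∧ ∀ v, φ (T v) = l v := by
  obtain ⟨σ, hσ⟩ := T.rangeRestrict.exists_rightInverse_of_surjective T.range_rangeRestrict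
  have hσ' : ∀ y : LinearMap.range T, T (σ y) = y := fun y =>
    congrArg Subtype.val (LinearMap.congr_fun hσ y)
  let f : StrongDual ℂ (LinearMap.range T) := LinearMap.mkContinuous (l ∘ₗ σ) 1 fun y => by
    rw [one_mul]
    refine (h (σ y)).trans_eq ?_
    rw [hσ']
    rfl
  obtain ⟨φ, hφ, hφn⟩ := exists_extension_norm_eq (LinearMap.range T) f
  refine ⟨φ, hφn ▸ LinearMap.mkContinuous_norm_le _ zero_le_one _, fun v => ?_⟩
  have h1 : φ (T v) = l (σ ⟨T v, v, rfl⟩) := hφ ⟨T v, v, rfl⟩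
  have h2 := h (σ ⟨T v, v, rfl⟩ - v)
  rw [map_sub T, hσ', sub_self, norm_zero, norm_le_zero_iff, map_sub, sub_eq_zero] at h2
  rw [h1, h2]

section

variable {G B X : Type*} [Group G] [TopologicalSpace B] [CompactSpace B] [MulAction G B]
    [ContinuousConstSMul G B] [TopologicalSpace X] [CompactSpace X] [T2Space X] [MulAction G X]
    [ContinuousConstSMul G X]

theorem norm_apply_one_le (b : B) (c : G →₀ C(B, ℂ)) : ‖c 1 b‖ ≤ ‖(regRep b).ev c‖ := by
  classical
  have h1 : (regRep b).ev c (lp.single 2 1 1) 1 = c 1 b := by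
    rw [regRep_ev_apply, Finset.sum_eq_single 1]
    · simp
    · intro s _ hs
      simp [hs]
    · intro h
      rw [Finsupp.notMem_support_iff.1 h]
      simp
  rw [← h1]
  refine (lp.norm_apply_le_norm (by norm_num) _ _).trans
    ((ContinuousLinearMap.le_opNorm _ _).trans_eq ?_)
  rw [lp.norm_single (by norm_num), norm_one, mul_one]

/-- `B` is a point for the group algebra and a boundary for a crossed product, whereas freeness is
obtained on `X`, where the means live. -/
theorem isTopologicallyFree_of_isCStarSimple [TopologicalSpace G] [DiscreteTopology G]
    (hX : IsGBoundary G X) {m : X → (G →ᵇ ℝ) → ℝ} (hm : ∀ x, IsMean (m x))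
    (hequiv : ∀ (s : G) x a, m (s • x) a = m x (bshift s a))
    (q : X → B) (hq : ∀ (s : G) x, q (s • x) = s • q x) {A : Type*} [CStarAlgebra A]
    (R : CovRep G B A) (hR : ∀ z c, ‖(regRep (q z)).ev c‖ ≤ ‖R.ev c‖)
    (hs : IsCStarSimple R.cstar) : IsTopologicallyFree G X := by
  classical
  intro s hs1
  by_contra hdense
  rw [dense_iff_inter_open] at hdense
  push Not at hdense
  obtain ⟨U, hU, ⟨x, hxU⟩, hUs⟩ := hdense
  have hfix : ∀ y ∈ U, s • y = y := fun y hy => by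
    by_contra h
    exact (hUs ▸ (⟨hy, h⟩ : y ∈ U ∩ {x | s • x ≠ x}) : y ∈ (∅ : Set X))
  have : Nonempty X := ⟨x⟩
  have : Nontrivial (EllTwo X) := ⟨lp.single 2 x 1, 0, fun h => by
    have := congrArg (fun v : EllTwo X => v x) h
    simp at this⟩
  let R' : CovRep G B (EllTwo X →L[ℂ] EllTwo X) := orbitRep q hq
  have hle : ∀ c, ‖R'.ev c‖ ≤ ‖R.ev c‖ := fun c =>
    norm_orbitRep_ev_le hm hequiv q hq c (norm_nonneg _) fun z => hR z c
  have hge := norm_ev_le_of_isCStarSimple R R' hle hs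
  obtain ⟨φ, hφ, hφl⟩ := exists_functional_of_norm_le R'.ev
    ((ContinuousMap.evalAlgHom ℂ ℂ (q x)).toLinearMap ∘ₗ Finsupp.lapply 1)
    fun c => (norm_apply_one_le (q x) c).trans ((hR x c).trans (hge c))
  -- The unitaries are those of `R'`, but all of `C(X)` now acts; `φ` is prescribed only on the
  -- algebra of `R'`, yet is defined on every operator.
  let RX : CovRep G X (EllTwo X →L[ℂ] EllTwo X) := orbitRep id fun _ _ => rfl
  have hu : ∀ t, φ (RX.u t) = if t = 1 then 1 else 0 := by
    intro t
    have h1 := hφl (Finsupp.single t 1)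
    rw [CovRep.ev_single, map_one, one_mul] at h1
    refine (show φ (RX.u t) = φ (R'.u t) from rfl).trans (h1.trans ?_)
    change (Finsupp.single t (1 : C(B, ℂ)) 1) (q x) = _
    rw [Finsupp.single_apply]
    split_ifs <;> simp
  have hφ1 : φ 1 = 1 := by
    have := hu 1
    rwa [map_one, if_pos rfl] at this
  obtain ⟨ψ, hψ, hψ1, hψcl, hl, -⟩ := exists_functional_eval hX RX hφ hφ1 x
  have hψs : ψ (RX.u s) = 0 := by
    have h0 : ∀ t, φ (RX.u t⁻¹ * RX.u s * RX.u t) = 0 := fun t => by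
      rw [← map_mul, ← map_mul, hu, if_neg]
      intro h
      refine hs1 ?_
      have : s = t * (t⁻¹ * s * t) * t⁻¹ := by group
      rw [this, h]
      group
    have h1 := hψcl (RX.u s)
    simp only [h0] at h1
    have h2 : ψ (RX.u s) ∈ closure {(0 : ℂ)} := closure_mono (by rintro _ ⟨t, rfl⟩; rfl) h1
    simpa using h2
  obtain ⟨f, hf0, hf1, -⟩ := exists_continuous_zero_one_of_isClosed hU.isClosed_compl
    (isClosed_singleton (x := x)) (by simpa using hxU)
  have hπ : RX.π (toComplex f) * RX.u s = RX.π (toComplex f) := by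
    ext ξ y
    change (f y : ℂ) * ξ (s⁻¹ • y) = (f y : ℂ) * ξ y
    by_cases hy : y ∈ U
    · rw [inv_smul_eq_iff.2 (hfix y hy).symm]
    · rw [hf0 hy]
      simp
  have h1 := hl (toComplex f) 1
  have h2 := hl (toComplex f) (RX.u s)
  rw [hπ, hψs, mul_zero] at h2
  rw [mul_one, h2, hψ1, toComplex_apply, hf1 (mem_singleton x)] at h1
  simp at h1

end

/-! ### The reduced C*-algebras as algebras of covariant representations -/

/-- The action of `G` on `G × X` by left translations of the first coordinate. -/
def leftPermProd (G X : Type*) [Group G] : G →* Equiv.Perm (G × X) where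
  toFun s := (Equiv.mulLeft s).prodCongr (Equiv.refl X)
  map_one' := by
    ext p
    · simp
    · rfl
  map_mul' s t := by
    ext p
    · simp [mul_assoc]
    · rfl

/-- The regular covariant representation on `ℓ²(G × X)`. -/
def crossRep (G X : Type*) [Group G] [TopologicalSpace X] [CompactSpace X] [MulAction G X]
    [ContinuousConstSMul G X] :
    CovRep G X (EllTwo (G × X) →L[ℂ] EllTwo (G × X)) :=
  permRep (leftPermProd G X) (fun p => p.1 • p.2) fun s p => mul_smul s p.1 p.2

section

variable {G X : Type*} [Group G] [TopologicalSpace X] [CompactSpace X] [MulAction G X]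
    [ContinuousConstSMul G X]

theorem crossRep_ev_apply (c : G →₀ C(X, ℂ)) (ξ : EllTwo (G × X)) (p : G × X) :
    (crossRep G X).ev c ξ p = ∑ s ∈ c.support, c s (p.1 • p.2) * ξ (s⁻¹ * p.1, p.2) :=
  permRep_ev_apply _ _ _ c ξ p

variable (G X) in
theorem reducedCrossedProduct_eq : reducedCrossedProduct G X = (crossRep G X).cstar :=
  congrArg StarSubalgebra.topologicalClosure (crossRep G X).adjoin_eq_alg

theorem reducedGroupCStar_le (x : X) : reducedGroupCStar G ≤ (regRep (G := G) x).cstar := by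
  refine StarSubalgebra.topologicalClosure_mono (StarAlgebra.adjoin_le ?_)
  rintro _ ⟨s, rfl⟩
  exact (regRep x).u_mem_alg s

theorem reducedGroupCStar_eq [Unique X] (x : X) :
    reducedGroupCStar G = (regRep (G := G) x).cstar := by
  refine le_antisymm (reducedGroupCStar_le x) (StarSubalgebra.topologicalClosure_mono ?_)
  rw [← CovRep.adjoin_eq_alg]
  refine StarAlgebra.adjoin_le ?_
  rintro _ (⟨f, rfl⟩ | ⟨s, rfl⟩)
  · have : f = algebraMap ℂ C(X, ℂ) (f x) := by
      ext y
      rw [Subsingleton.elim y x]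
      simp
    rw [this, AlgHomClass.commutes]
    exact StarSubalgebra.algebraMap_mem _ _
  · exact StarAlgebra.subset_adjoin ℂ _ ⟨s, rfl⟩

/-- The slice `G × {x}` carries a copy of `regRep x` inside `crossRep G X`. -/
theorem norm_regRep_ev_le (x : X) (c : G →₀ C(X, ℂ)) :
    ‖(regRep x).ev c‖ ≤ ‖(crossRep G X).ev c‖ := by
  classical
  refine ContinuousLinearMap.opNorm_le_bound _ (norm_nonneg _) fun ξ => ?_
  have hsum : ∀ v : EllTwo G,
      ∑' p : G × X, ‖if p.2 = x then v p.1 else 0‖ₑ ^ 2 = ‖v‖ₑ ^ 2 := by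
    intro v
    rw [ENNReal.tsum_prod (f := fun t y => ‖if y = x then v t else 0‖ₑ ^ 2),
      EllTwo.enorm_sq_eq_tsum]
    refine tsum_congr fun t => ?_
    rw [tsum_eq_single x fun y hy => by simp [hy], if_pos rfl]
  let V : EllTwo G → EllTwo (G × X) := fun v => ⟨fun p => if p.2 = x then v p.1 else 0,
    memℓp_two_of_tsum_ne_top (by rw [hsum]; simp)⟩
  have hV : ∀ v, ‖V v‖ = ‖v‖ := fun v => by
    have h1 : ‖V v‖ₑ ^ 2 = ‖v‖ₑ ^ 2 := (EllTwo.enorm_sq_eq_tsum (V v)).trans (hsum v)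
    have h2 : ‖V v‖ₑ = ‖v‖ₑ := (ENNReal.pow_right_strictMono two_ne_zero).injective h1
    exact (enorm_eq_iff_norm_eq).1 h2
  have hint : (crossRep G X).ev c (V ξ) = V ((regRep x).ev c ξ) := by
    ext p
    rw [crossRep_ev_apply]
    change ∑ s ∈ c.support, c s (p.1 • p.2) * (if p.2 = x then ξ (s⁻¹ * p.1) else 0) =
      if p.2 = x then (regRep x).ev c ξ p.1 else 0
    split_ifs with h
    · rw [regRep_ev_apply, h]
    · simp
  rw [← hV, ← hint, ← hV ξ]
  exact ContinuousLinearMap.le_opNorm _ _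

end

theorem EllTwo.clm_eq_zero {ι E : Type*} [DecidableEq ι] [NormedAddCommGroup E] [NormedSpace ℂ E]
    (T : EllTwo ι →L[ℂ] E) (h : ∀ i, T (lp.single 2 i 1) = 0) : T = 0 := by
  ext ξ
  have h1 := (lp.hasSum_single (by norm_num) ξ).mapL T
  have h2 : ∀ i, T (lp.single 2 i (ξ i)) = 0 := fun i => by
    have : lp.single (E := fun _ : ι => ℂ) 2 i (ξ i) = ξ i • lp.single 2 i 1 := by
      rw [← lp.single_smul, smul_eq_mul, mul_one]
    rw [this, map_smul, h, smul_zero]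
  simp only [h2] at h1
  exact h1.unique hasSum_zero

/-! ### Simplicity of the two algebras, and freeness along factor maps -/

section

variable {G X : Type*} [Group G] [TopologicalSpace X] [CompactSpace X] [T2Space X] [MulAction G X]
    [ContinuousConstSMul G X]

theorem isCStarSimple_reducedGroupCStar (hX : IsGBoundary G X) (hfree : IsTopologicallyFree G X) :
    IsCStarSimple (reducedGroupCStar G) := by
  classical
  obtain ⟨x⟩ := hX.nonempty
  have : Nontrivial (EllTwo G) := ⟨lp.single 2 1 1, 0, fun h => by
    have := congrArg (fun v : EllTwo G => v 1) h
    simp at this⟩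
  refine isCStarSimple_of_isTopologicallyFree hX hfree (regRep x) _
    (StarSubalgebra.isClosed_topologicalClosure _) (reducedGroupCStar_le x)
    (fun s => subset_closure (StarAlgebra.subset_adjoin ℂ _ ⟨s, rfl⟩)) {lp.single 2 1 1} ?_ ?_
  · rintro _ rfl c
    rw [lp.inner_single_left, regRep_ev_apply, Finset.sum_eq_single 1]
    · simpa using (c 1).norm_coe_le_norm x
    · intro s _ hs
      simp [hs]
    · intro h
      rw [Finsupp.notMem_support_iff.1 h]
      simp
  · intro T hT
    refine EllTwo.clm_eq_zero T fun t => ?_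
    rw [← hT _ (mem_singleton _) t]
    congr 1
    ext r
    change _ = lp.single (E := fun _ : G => ℂ) 2 1 1 (t⁻¹ * r)
    rw [lp.single_apply, lp.single_apply, Pi.single_apply, Pi.single_apply]
    simp only [inv_mul_eq_one, eq_comm]

theorem isCStarSimple_reducedCrossedProduct (hX : IsGBoundary G X)
    (hfree : IsTopologicallyFree G X) : IsCStarSimple (reducedCrossedProduct G X) := by
  classical
  obtain ⟨x⟩ := hX.nonempty
  have : Nontrivial (EllTwo (G × X)) := ⟨lp.single 2 (1, x) 1, 0, fun h => by
    have := congrArg (fun v : EllTwo (G × X) => v (1, x)) h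
    simp at this⟩
  rw [reducedCrossedProduct_eq]
  refine isCStarSimple_of_isTopologicallyFree hX hfree (crossRep G X) _
    (crossRep G X).isClosed_cstar le_rfl
    (fun s => subset_closure ((crossRep G X).u_mem_alg s))
    (range fun y : X => lp.single 2 (1, y) 1) ?_ ?_
  · rintro _ ⟨y, rfl⟩ c
    rw [lp.inner_single_left, crossRep_ev_apply, Finset.sum_eq_single 1]
    · simpa using (c 1).norm_coe_le_norm y
    · intro s _ hs
      simp [hs]
    · intro h
      rw [Finsupp.notMem_support_iff.1 h]
      simp
  · intro T hT
    refine EllTwo.clm_eq_zero T fun p => ?_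
    rw [← hT _ (mem_range_self p.2) p.1]
    congr 1
    ext r
    change _ = lp.single (E := fun _ : G × X => ℂ) 2 (1, p.2) 1 (p.1⁻¹ * r.1, r.2)
    rw [lp.single_apply, lp.single_apply, Pi.single_apply, Pi.single_apply]
    simp only [Prod.ext_iff, inv_mul_eq_one, eq_comm]

omit [T2Space X] in
-- If `s` fixes an open set, finitely many translates of it cover `X` by minimality, so every point
-- of `B` is fixed by one of finitely many nontrivial conjugates of `s`. Freeness on `B` forbids
-- this.
theorem IsTopologicallyFree.of_factor [MulAction.IsMinimal G X] {B : Type*} [TopologicalSpace B]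
    [CompactSpace B] [T2Space B] [MulAction G B] [ContinuousConstSMul G B] [Nonempty B]
    {φ : X → B} (hφ : Function.Surjective φ) (hequiv : ∀ (s : G) x, φ (s • x) = s • φ x)
    (hB : IsTopologicallyFree G B) : IsTopologicallyFree G X := by
  intro s hs1
  by_contra hdense
  rw [dense_iff_inter_open] at hdense
  push Not at hdense
  obtain ⟨U, hU, hne, hUs⟩ := hdense
  have hfix : ∀ y ∈ U, s • y = y := fun y hy => by
    by_contra h
    exact (hUs ▸ (⟨hy, h⟩ : y ∈ U ∩ {x | s • x ≠ x}) : y ∈ (∅ : Set X))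
  obtain ⟨I, hI⟩ := isCompact_univ.exists_finite_cover_smul G hU hne
  have hD : Dense (⋂ g ∈ (I : Set G), {b : B | (g * s * g⁻¹) • b ≠ b}) :=
    dense_biInter_of_isOpen
      (fun g _ => isOpen_ne_fun (continuous_const_smul (g * s * g⁻¹)) continuous_id)
      I.countable_toSet fun g _ => hB _ fun h => hs1 (by simpa using h)
  obtain ⟨b, hb⟩ := hD.nonempty
  obtain ⟨x, rfl⟩ := hφ b
  obtain ⟨g, hg, y, hy, hyx⟩ := mem_iUnion₂.1 (hI (mem_univ x))
  refine mem_iInter₂.1 hb g hg ?_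
  have : (g * s * g⁻¹) • x = x := by
    rw [← hyx]
    change (g * s * g⁻¹) • g • y = g • y
    rw [mul_smul, inv_smul_smul, mul_smul, hfix y hy]
  rw [← hequiv, this]

end

end

theorem mainTheorem1 (G : Type u) [Group G] :
    (∃ (X : Type u) (_ : TopologicalSpace X) (_ : CompactSpace X) (_ : T2Space X)
      (_ : MulAction G X) (_ : ContinuousConstSMul G X), IsFurstenbergBoundary G X) ∧
    ∀ (X : Type u) [TopologicalSpace X] [CompactSpace X] [T2Space X] [MulAction G X]
      [ContinuousConstSMul G X], IsFurstenbergBoundary G X →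
      List.TFAE [
        IsCStarSimple (reducedGroupCStar G),
        IsCStarSimple (reducedCrossedProduct G X),
        ∃ (B : Type u) (_ : TopologicalSpace B) (_ : CompactSpace B) (_ : T2Space B)
          (_ : MulAction G B) (_ : ContinuousConstSMul G B),
          IsGBoundary G B ∧ IsCStarSimple (reducedCrossedProduct G B),
        IsTopologicallyFree G X,
        ∃ (B : Type u) (_ : TopologicalSpace B) (_ : CompactSpace B) (_ : T2Space B)
          (_ : MulAction G B) (_ : ContinuousConstSMul G B),
          IsGBoundary G B ∧ IsTopologicallyFree G B] := by
  let : TopologicalSpace G := ⊥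
  have : DiscreteTopology G := ⟨rfl⟩
  obtain ⟨X₀, _, _, _, _, _, hX₀, m, hm, hequiv⟩ := exists_isFurstenbergBoundary_means G
  refine ⟨⟨X₀, _, ‹_›, ‹_›, _, ‹_›, hX₀⟩, ?_⟩
  intro X _ _ _ _ _ hX
  -- The means live on the constructed `X₀`; pulling them back along `r` puts them on an arbitrary
  -- Furstenberg boundary.
  obtain ⟨r, -, -, hr⟩ := hX.universal X₀ hX₀.isGBoundary
  have hm' : ∀ x, IsMean (m (r x)) := fun x => hm (r x)
  have hequiv' : ∀ (s : G) x a, m (r (s • x)) a = m (r x) (bshift s a) := fun s x a => by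
    rw [hr, hequiv]
  have hmin : MulAction.IsMinimal G X := hX.isGBoundary.minimal
  tfae_have 1 → 4 := fun h => by
    -- Over a one-point space the functions are scalars, so the covariant algebra is the reduced
    -- group algebra.
    rw [reducedGroupCStar_eq (PUnit.unit : PUnit.{u + 1})] at h
    exact isTopologicallyFree_of_isCStarSimple hX.isGBoundary hm' hequiv'
      (fun _ => (PUnit.unit : PUnit.{u + 1})) (fun _ _ => rfl) _ (fun _ _ => le_rfl) h
  tfae_have 4 → 1 := fun h => isCStarSimple_reducedGroupCStar hX.isGBoundary h
  tfae_have 4 → 2 := fun h => isCStarSimple_reducedCrossedProduct hX.isGBoundary h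
  tfae_have 2 → 3 := fun h => ⟨X, _, ‹_›, ‹_›, _, ‹_›, hX.isGBoundary, h⟩
  tfae_have 3 → 4 := by
    rintro ⟨B, _, _, _, _, _, hB, h⟩
    obtain ⟨q, -, -, hq⟩ := hX.universal B hB
    rw [reducedCrossedProduct_eq] at h
    exact isTopologicallyFree_of_isCStarSimple hX.isGBoundary hm' hequiv' q hq _
      (fun z c => norm_regRep_ev_le (q z) c) h
  tfae_have 4 → 5 := fun h => ⟨X, _, ‹_›, ‹_›, _, ‹_›, hX.isGBoundary, h⟩
  tfae_have 5 → 4 := by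
    rintro ⟨B, _, _, _, _, _, hB, h⟩
    obtain ⟨q, -, hqs, hq⟩ := hX.universal B hB
    have : Nonempty B := hB.nonempty
    exact h.of_factor hqs hq
  tfae_finish
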